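/- Let $n\ge 2$ and $m\ge 1$ be integers, and let $\mathcal H(\mathbb R^n,\mathbb R^m)$ be the real vector space of harmonic maps $f=(f_1,\dots,f_m):\mathbb R^n\to\mathbb R^m$ (each $f_i$ is smooth and $\Delta f_i=0$), equipped with the compact-open topology. For $a\in\mathbb R^n$ let $\mathsf T_a$ be the translation operator $(\mathsf T_af)(x)=f(x+a)$ on this space, and let $\mathsf{HC}(\mathsf T_a)$ be the set of its hypercyclic elements, i.e. of those $f$ whose orbit $\{f,\mathsf T_af,\mathsf T_a^2f,\dots\}$ is dense in $\mathcal H(\mathbb R^n,\mathbb R^m)$. Let $\phi:\mathbb R_{\ge 0}\to\mathbb R_{>0}$ be a continuous function with $\lim_{r\to\infty}\phi(r)/r^N=\infty$ for every integer $N\ge 1$, and put $$\mathsf S_\phi=\{f\in\mathcal H(\mathbb R^n,\mathbb R^m):\ \|f(x)\|\le\phi(\|x\|)\ \text{ for all }x\in\mathbb R^n\},$$ where $\|\cdot\|$ denotes the Euclidean norms. Theorem. For every sequence $(e^{[k]})_{k\in\mathbb N}$ in the unit sphere $\mathbb S^{n-1}\subset\mathbb R^n$ there exist a real Banach space $\mathbf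 B$, an injective continuous linear map $\iota:\mathbf B\to\mathcal H(\mathbb R^n,\mathbb R^m)$ and a dense $G_\delta$ subset $G\subset\mathbf B$ such that $$\iota\bigl(G\cap\mathbb B(0,1)\bigr)\ \subset\ \bigcap_{k\in\mathbb N}\ \bigcap_{r>0}\mathsf{HC}(\mathsf T_{r e^{[k]}})\ \cap\ \mathsf S_\phi ,$$ where $\mathbb B(0,1)$ is the closed unit ball of $\mathbf B$ centered at $0$. -/

import Mathlib

open scoped NNReal ContDiff

/-- The real vector space `𝓗(ℝⁿ, ℝᵐ)` of harmonic maps `ℝⁿ → ℝᵐ`: every component is a smooth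
function in the kernel of the Laplacian. As a subspace of `C(ℝⁿ, ℝᵐ)` it carries the compact-open
topology. -/
noncomputable def HarmonicMaps (n m : ℕ) :
    Submodule ℝ C(EuclideanSpace ℝ (Fin n), EuclideanSpace ℝ (Fin m)) where
  carrier := {f | ∀ i : Fin m, ContDiff ℝ ∞ (fun x : EuclideanSpace ℝ (Fin n) => f x i) ∧
    ∀ x : EuclideanSpace ℝ (Fin n),
      Laplacian.laplacian (fun y : EuclideanSpace ℝ (Fin n) => f y i) x = 0}
  add_mem' := by
    intro f g hf hg i
    have h2 : (2 : WithTop ℕ∞) ≤ ∞ := WithTop.coe_le_coe.2 (le_top : (2 : ℕ∞) ≤ ⊤)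
    refine ⟨(hf i).1.add (hg i).1, fun x => ?_⟩
    have h := ContDiffAt.laplacian_add (x := x) ((hf i).1.of_le h2).contDiffAt
      ((hg i).1.of_le h2).contDiffAt
    rw [(hf i).2 x, (hg i).2 x, add_zero] at h
    exact h
  zero_mem' := by
    intro i
    refine ⟨contDiff_const, fun x => ?_⟩
    have h := congrFun (InnerProductSpace.laplacian_const (E := EuclideanSpace ℝ (Fin n)) (c := (0 : ℝ))) x
    exact h
  smul_mem' := by
    intro c f hf i
    have h2 : (2 : WithTop ℕ∞) ≤ ∞ := WithTop.coe_le_coe.2 (le_top : (2 : ℕ∞) ≤ ⊤)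
    refine ⟨(hf i).1.const_smul c, fun x => ?_⟩
    have h := InnerProductSpace.laplacian_smul (x := x) c ((hf i).1.of_le h2).contDiffAt
    rw [(hf i).2 x, smul_zero] at h
    exact h

/-- The translation operator `(T_a f)(x) = f (x + a)` on `𝓗(ℝⁿ, ℝᵐ)`, a continuous linear map. -/
noncomputable def harmonicTranslation {n m : ℕ} (a : EuclideanSpace ℝ (Fin n)) :
    HarmonicMaps n m →L[ℝ] HarmonicMaps n m where
  toFun f := ⟨(f : C(EuclideanSpace ℝ (Fin n), EuclideanSpace ℝ (Fin m))).comp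
      ⟨fun x => x + a, by fun_prop⟩, by
    intro i
    refine ⟨(f.2 i).1.comp (contDiff_id.add contDiff_const), fun x => ?_⟩
    have h := (f.2 i).2 (x + a)
    rw [InnerProductSpace.laplacian_eq_iteratedFDeriv_stdOrthonormalBasis] at h ⊢
    simp only [← h]
    refine Finset.sum_congr rfl fun j _ => ?_
    have := iteratedFDeriv_comp_add_right (𝕜 := ℝ) (f := fun y => f.1 y i) 2 a x
    exact congrArg (fun L => L ![stdOrthonormalBasis ℝ _ j, stdOrthonormalBasis ℝ _ j]) this⟩
  map_add' _ _ := rfl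
  map_smul' _ _ := rfl
  cont := by
    refine Continuous.subtype_mk ?_ _
    exact (ContinuousMap.continuous_precomp _).comp continuous_subtype_val

/-- `HC(T)`: the set of hypercyclic elements of `T : X → X`, i.e. those whose orbit
`{x, T x, T² x, …}` is dense. -/
def HypercyclicElements {X : Type*} [TopologicalSpace X] (T : X → X) : Set X :=
  {x | Dense (Set.range fun k : ℕ => T^[k] x)}

/-- `S_φ`: the harmonic maps `f` with `‖f x‖ ≤ φ ‖x‖` for all `x` (Euclidean norms). -/
def SlowGrowthHarmonic (n m : ℕ) (φ : ℝ≥0 → ℝ) : Set (HarmonicMaps n m) :=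
  {f | ∀ x : EuclideanSpace ℝ (Fin n),
    ‖(f : C(EuclideanSpace ℝ (Fin n), EuclideanSpace ℝ (Fin m))) x‖ ≤ φ ‖x‖₊}

/-!
The operators `∂_v` and multiplication by `⟪w, ·⟫` on smooth maps satisfy the Heisenberg relations,
and most of the algebra below only uses these. Polynomial maps are the smooth maps killed by all
`K`-fold derivatives for some `K`.

**Surjectivity.** In dimension at least two, `∂_v` maps the harmonic polynomials onto themselves
(`exists_harmonicPolynomial_dirDeriv_eq`): take any polynomial primitive `p`; then `Δ p` is killed by
`∂_v`, and it is the Laplacian of a polynomial killed by `∂_v`, found by integrating along a second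
direction `w` orthogonal to `v`.

**Density.** With a smooth radial weight, a continuous map is harmonic if and only if it has the mean
value property. Hence harmonic maps are closed in the compact-open topology (`isClosed_harmonic`) and
satisfy a gradient estimate, from which the Taylor polynomials, which are harmonic, converge locally
uniformly (`exists_harmonicPolynomial_norm_sub_le`).

**Transitivity.** For harmonic polynomials `f`, `g` and `a ≠ 0`, a combination of iterated primitives
of `f` and `g` in the direction `a`, with coefficients that are negative powers of `t`, gives
perturbations `u t → 0` such that the translate of `f + u t` by `t a` tends to `g`
(`exists_decaying_perturbation`). All polynomials involved have bounded degree, so this convergence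
holds in every vector space topology, in particular in a Banach space of slowly growing maps.

**The Banach space.** Let `w x = φ ‖x‖`. The harmonic polynomials divided by `w` are bounded, and `B`
is their closure in the bounded continuous maps; `ι` multiplies by `w`. By closedness `ι` takes values
in the harmonic maps, and `ι` maps the unit ball into `S_φ` by construction. Transitivity and Baire's
theorem yield a dense `G_δ` of elements which are hypercyclic for any countable family of nonzero
translations.

**All step lengths.** For a fixed `r > 0` there is, by the same argument, some `g` hypercyclic for
`T_{re}`, and then so is each `T_{θe} g`. If `f` is hypercyclic for `T_e`, some `T_e^k f` is close to
`g`, and a further translation by `θ ∈ [0, r]` makes the total length a multiple of `r`. So `f` is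
hypercyclic for every `T_{re}` (`hypercyclicElements_smul`), and the countable family `T_{e_k}` suffices.
-/

/-! ### Heisenberg relations and smooth maps -/

section Heisenberg

variable {X : Type*} [AddCommGroup X] [Module ℝ X]

/-- If `[D, M] = 1`, repeated integration by parts inverts `D` on the elements killed by a power of
`D`: `Y = ∑ (-1)^j M^(j+1) D^j / (j+1)!`, a polynomial in `D` and `M`. -/
theorem exists_antiderivative {D M : Module.End ℝ X} (hDM : D * M = M * D + 1)
    {P : Submodule ℝ X} (hDP : ∀ f ∈ P, D f ∈ P) (hMP : ∀ f ∈ P, M f ∈ P)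
    {q : X} {K : ℕ} (hq : (D ^ K) q = 0) :
    ∃ Y : Module.End ℝ X, D (Y q) = q ∧ (∀ f ∈ P, Y f ∈ P) ∧
      ∀ Z : Module.End ℝ X, Commute Z D → Commute Z M → Commute Z Y := by
  have hpow : ∀ j : ℕ, D * M ^ (j + 1) = M ^ (j + 1) * D + ((j : ℝ) + 1) • M ^ j := by
    intro j
    induction j with
    | zero => simp [hDM]
    | succ j ih =>
      rw [pow_succ _ (j + 1), ← mul_assoc, ih, add_mul, mul_assoc _ D M, hDM, smul_mul_assoc,
        ← pow_succ]
      push_cast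
      rw [mul_add, mul_one, add_smul (_ + _) (1 : ℝ), one_smul, mul_assoc]
      abel
  refine ⟨∑ j ∈ Finset.range K, ((-1 : ℝ) ^ j / (j + 1).factorial) • (M ^ (j + 1) * D ^ j),
    ?_, ?_, ?_⟩
  · -- The sum telescopes.
    have key : ∀ K : ℕ, D ((∑ j ∈ Finset.range K,
        ((-1 : ℝ) ^ j / (j + 1).factorial) • (M ^ (j + 1) * D ^ j)) q) =
        q - ((-1 : ℝ) ^ K / K.factorial) • (M ^ K * D ^ K) q := by
      intro K
      induction K with
      | zero => simp
      | succ K ih =>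
        rw [Finset.sum_range_succ, LinearMap.add_apply, map_add, ih, LinearMap.smul_apply, map_smul,
          ← Module.End.mul_apply D, ← mul_assoc, hpow, add_mul, mul_assoc, ← pow_succ',
          smul_mul_assoc, LinearMap.add_apply, LinearMap.smul_apply, smul_add, smul_smul]
        have h1 : (-1 : ℝ) ^ K / (K + 1).factorial * (K + 1) = (-1 : ℝ) ^ K / K.factorial := by
          rw [Nat.factorial_succ]; push_cast
          have := Nat.factorial_ne_zero K
          field_simp
        rw [h1, pow_succ (-1 : ℝ)]
        module
    rw [key K, Module.End.mul_apply, hq, map_zero, smul_zero, sub_zero]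
  · intro f hf
    have hpowP {A : Module.End ℝ X} (hA : ∀ f ∈ P, A f ∈ P) (j : ℕ) : ∀ f ∈ P, (A ^ j) f ∈ P := by
      induction j with
      | zero => exact fun f hf => hf
      | succ j ih => exact fun f hf => by rw [pow_succ]; exact ih _ (hA f hf)
    rw [LinearMap.sum_apply]
    exact sum_mem fun j _ => P.smul_mem _ (hpowP hMP (j + 1) ((D ^ j) f) (hpowP hDP j f hf))
  · intro Z hD hM
    refine Commute.sum_right _ _ _ fun j _ => ?_
    exact ((hM.pow_right _).mul_right (hD.pow_right _)).smul_right _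

/-- An operator `Δ` with `[Δ, M] = 2 D`, where `[D, M] = 1`, is onto on the elements killed by an
operator `D'` commuting with everything in sight: `Δ - D²` commutes with `D` and `M`, so integrating
twice with respect to `D` solves the equation up to an element on which `Δ - D²` is nilpotent of
smaller order. -/
theorem exists_apply_eq_of_heisenberg {D D' M Δ : Module.End ℝ X} (hDM : D * M = M * D + 1)
    (hΔM : Δ * M = M * Δ + (2 : ℝ) • D) (hDΔ : Commute D Δ) (hD'D : Commute D' D)
    (hD'M : Commute D' M) (hD'Δ : Commute D' Δ) {P : Submodule ℝ X} (hDP : ∀ f ∈ P, D f ∈ P)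
    (hMP : ∀ f ∈ P, M f ∈ P) (hΔP : ∀ f ∈ P, Δ f ∈ P) (hnil : ∀ f ∈ P, ∃ K : ℕ, (D ^ K) f = 0)
    (J : ℕ) : ∀ q ∈ P, D' q = 0 → ((Δ - D ^ 2) ^ J) q = 0 → ∃ u ∈ P, D' u = 0 ∧ Δ u = q := by
  set L : Module.End ℝ X := Δ - D ^ 2 with hL
  have hD'L : Commute D' L := hD'Δ.sub_right (hD'D.pow_right 2)
  have hLD : Commute L D := hDΔ.symm.sub_left ((Commute.refl _).pow_left 2)
  have hLM : Commute L M := by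
    rw [commute_iff_eq, hL, sub_mul, hΔM, pow_two, mul_assoc, hDM, mul_add,
      ← mul_assoc, hDM, mul_sub, add_mul, mul_assoc, two_smul, one_mul, mul_one]
    abel
  induction J with
  | zero =>
    intro q _ _ h0
    exact ⟨0, zero_mem _, map_zero _, by simpa using h0.symm⟩
  | succ J ih =>
    intro q hq hvq hJ
    have hprim : ∀ q ∈ P, ∃ y ∈ P, D y = q ∧
        ∀ Z : Module.End ℝ X, Commute Z D → Commute Z M → Z q = 0 → Z y = 0 := by
      intro q hq
      obtain ⟨K, hK⟩ := hnil q hq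
      obtain ⟨Y, hY, hP, hZ⟩ := exists_antiderivative hDM hDP hMP hK
      refine ⟨Y q, hP q hq, hY, fun Z h1 h2 h0 => ?_⟩
      rw [← Module.End.mul_apply, (hZ Z h1 h2).eq, Module.End.mul_apply, h0, map_zero]
    obtain ⟨z, hz, hzq, hzZ⟩ := hprim q hq
    obtain ⟨y, hy, hyz, hyZ⟩ := hprim z hz
    have hvy : D' y = 0 := hyZ _ hD'D hD'M (hzZ _ hD'D hD'M hvq)
    have hLy : (L ^ (J + 1)) y = 0 :=
      hyZ _ (hLD.pow_left _) (hLM.pow_left _) (hzZ _ (hLD.pow_left _) (hLM.pow_left _) hJ)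
    have hLq : Δ y = q + L y := by
      rw [hL, LinearMap.sub_apply, pow_two, Module.End.mul_apply, hyz, hzq]
      abel
    have hLyP : L y ∈ P := by
      rw [← sub_eq_iff_eq_add'.2 hLq]
      exact sub_mem (hΔP y hy) hq
    obtain ⟨u, hu, hvu, huL⟩ := ih (L y) hLyP
      (by rw [← Module.End.mul_apply, hD'L.eq, Module.End.mul_apply, hvy, map_zero])
      (by rw [← Module.End.mul_apply, ← pow_succ]; exact hLy)
    refine ⟨y - u, sub_mem hy hu, by rw [map_sub, hvy, hvu, sub_zero], ?_⟩
    rw [map_sub, hLq, huL, add_sub_cancel_right]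

end Heisenberg

section Smooth

theorem two_le_infty : (2 : WithTop ℕ∞) ≤ ∞ :=
  WithTop.coe_le_coe.2 (le_top : (2 : ℕ∞) ≤ ⊤)

variable (E F : Type*) [NormedAddCommGroup E] [InnerProductSpace ℝ E]
  [NormedAddCommGroup F] [NormedSpace ℝ F]

/-- The real vector space of smooth maps `E → F`. -/
def SmoothMaps : Submodule ℝ (E → F) where
  carrier := {f | ContDiff ℝ ∞ f}
  add_mem' {f g} (hf : ContDiff ℝ ∞ f) (hg : ContDiff ℝ ∞ g) := hf.add hg
  zero_mem' := contDiff_zero_fun (𝕜 := ℝ) (n := ∞)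
  smul_mem' c f (hf : ContDiff ℝ ∞ f) := hf.const_smul c

variable {E F}

theorem SmoothMaps.contDiff (f : SmoothMaps E F) : ContDiff ℝ ∞ f.1 := f.2

theorem SmoothMaps.differentiable (f : SmoothMaps E F) : Differentiable ℝ f.1 :=
  (contDiff f).differentiable (by simp)

theorem SmoothMaps.continuous (f : SmoothMaps E F) : Continuous f.1 :=
  (contDiff f).continuous

theorem ContDiff.fderiv_apply_const {f : E → F} (hf : ContDiff ℝ ∞ f) (v : E) :
    ContDiff ℝ ∞ (fun x => fderiv ℝ f x v) :=
  (hf.fderiv_right (m := ∞) (by simp)).clm_apply contDiff_const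

/-- The directional derivative `∂_v` as an operator on smooth maps. -/
noncomputable def dirDeriv (v : E) : Module.End ℝ (SmoothMaps E F) where
  toFun f := ⟨fun x => fderiv ℝ f.1 x v, (SmoothMaps.contDiff f).fderiv_apply_const v⟩
  map_add' f g := by
    ext x
    simp [fderiv_add (SmoothMaps.differentiable f x) (SmoothMaps.differentiable g x)]
  map_smul' c f := by
    ext x
    simp [fderiv_const_smul (SmoothMaps.differentiable f x)]

/-- Multiplication by the linear form `⟪w, ·⟫`, as an operator on smooth maps. -/
noncomputable def mulInner (w : E) : Module.End ℝ (SmoothMaps E F) where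
  toFun f := ⟨fun x => inner ℝ w x • f.1 x,
    (contDiff_const.inner ℝ contDiff_id).smul (SmoothMaps.contDiff f)⟩
  map_add' f g := by ext x; simp
  map_smul' c f := by ext x; simp [smul_comm c]

theorem dirDeriv_apply (v : E) (f : SmoothMaps E F) (x : E) :
    (dirDeriv v f).1 x = fderiv ℝ f.1 x v := rfl

theorem mulInner_apply (v : E) (f : SmoothMaps E F) (x : E) :
    (mulInner v f).1 x = inner ℝ v x • f.1 x := rfl

theorem dirDeriv_smul (c : ℝ) (v : E) : (dirDeriv (c • v) : Module.End ℝ (SmoothMaps E F)) =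
    c • dirDeriv v := by
  ext f x; simp [dirDeriv_apply]

theorem dirDeriv_dirDeriv_apply (v w : E) (f : SmoothMaps E F) (x : E) :
    (dirDeriv v (dirDeriv w f)).1 x = fderiv ℝ (fderiv ℝ f.1) x v w := by
  have h : DifferentiableAt ℝ (fderiv ℝ f.1) x :=
    (((SmoothMaps.contDiff f).fderiv_right (m := ∞) (by simp)).differentiable (by simp)) x
  change fderiv ℝ (fun y => fderiv ℝ f.1 y w) x v = _
  rw [fderiv_clm_apply h (differentiableAt_const w)]
  simp

theorem dirDeriv_commute (v w : E) :
    Commute (dirDeriv v : Module.End ℝ (SmoothMaps E F)) (dirDeriv w) := by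
  ext f x
  simp only [Module.End.mul_apply]
  rw [dirDeriv_dirDeriv_apply, dirDeriv_dirDeriv_apply]
  have h : ContDiffAt ℝ ∞ f.1 x := (SmoothMaps.contDiff f).contDiffAt
  exact (h.isSymmSndFDerivAt (by simpa using two_le_infty)) v w

/-- The canonical commutation relation between `∂_v` and multiplication by `⟪w, ·⟫`. -/
theorem dirDeriv_mul_mulInner (v w : E) :
    (dirDeriv v : Module.End ℝ (SmoothMaps E F)) * mulInner w =
      mulInner w * dirDeriv v + (inner ℝ w v : ℝ) • 1 := by
  ext f x
  simp only [Module.End.mul_apply, LinearMap.add_apply, LinearMap.smul_apply, Module.End.one_apply]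
  change fderiv ℝ (fun y => inner ℝ w y • f.1 y) x v =
    inner ℝ w x • fderiv ℝ f.1 x v + (inner ℝ w v : ℝ) • f.1 x
  have h1 : HasFDerivAt (fun y : E => (inner ℝ w y : ℝ)) (innerSL ℝ w) x :=
    (innerSL ℝ w).hasFDerivAt
  have h2 := (h1.smul (SmoothMaps.differentiable f x).hasFDerivAt).fderiv
  rw [Pi.smul_def'] at h2
  rw [h2]
  simp

variable [FiniteDimensional ℝ E]

/-- The Laplacian as an operator on smooth maps. -/
noncomputable def smoothLaplacian : Module.End ℝ (SmoothMaps E F) :=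
  ∑ i, dirDeriv (stdOrthonormalBasis ℝ E i) ^ 2

theorem smoothLaplacian_apply (f : SmoothMaps E F) (x : E) :
    (smoothLaplacian f).1 x = Laplacian.laplacian f.1 x := by
  rw [InnerProductSpace.laplacian_eq_iteratedFDeriv_stdOrthonormalBasis]
  simp only [smoothLaplacian, LinearMap.sum_apply, Submodule.coe_sum, Finset.sum_apply, pow_two,
    Module.End.mul_apply, iteratedFDeriv_two_apply, dirDeriv_dirDeriv_apply]
  simp

theorem commute_dirDeriv_smoothLaplacian (v : E) :
    Commute (dirDeriv v : Module.End ℝ (SmoothMaps E F)) smoothLaplacian :=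
  Commute.sum_right _ _ _ fun _ _ => (dirDeriv_commute _ _).pow_right _

theorem sum_inner_smul_dirDeriv (v : E) :
    ∑ i, (inner ℝ (stdOrthonormalBasis ℝ E i) v : ℝ) • dirDeriv (stdOrthonormalBasis ℝ E i) =
      (dirDeriv v : Module.End ℝ (SmoothMaps E F)) := by
  conv_rhs => rw [← (stdOrthonormalBasis ℝ E).sum_repr' v]
  ext f x
  simp [dirDeriv_apply, LinearMap.sum_apply]

theorem smoothLaplacian_mul_mulInner (w : E) :
    (smoothLaplacian : Module.End ℝ (SmoothMaps E F)) * mulInner w =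
      mulInner w * smoothLaplacian + (2 : ℝ) • dirDeriv w := by
  have h (v : E) : (dirDeriv v : Module.End ℝ (SmoothMaps E F)) ^ 2 * mulInner w =
      mulInner w * dirDeriv v ^ 2 + (2 : ℝ) • (inner ℝ v w : ℝ) • dirDeriv v := by
    rw [pow_two, mul_assoc, dirDeriv_mul_mulInner, mul_add, ← mul_assoc, dirDeriv_mul_mulInner,
      mul_smul_comm, add_mul, mul_assoc, real_inner_comm]
    simp only [smul_mul_assoc, one_mul, mul_one]
    module
  rw [smoothLaplacian, Finset.sum_mul, Finset.mul_sum, ← sum_inner_smul_dirDeriv w, Finset.smul_sum,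
    ← Finset.sum_add_distrib]
  exact Finset.sum_congr rfl fun i _ => h _

end Smooth

/-! ### Polynomial and harmonic polynomial maps -/

section Polynomial

variable {E F : Type*} [NormedAddCommGroup E] [InnerProductSpace ℝ E]
  [NormedAddCommGroup F] [NormedSpace ℝ F]

/-- The polynomial maps `E → F` of degree `< K`, encoded as the smooth maps all of whose `K`-fold
directional derivatives vanish. -/
noncomputable def polyDegreeLT : ℕ → Submodule ℝ (SmoothMaps E F)
  | 0 => ⊥
  | K + 1 => ⨅ v : E, (polyDegreeLT K).comap (dirDeriv v)

theorem mem_polyDegreeLT_succ {K : ℕ} {f : SmoothMaps E F} :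
    f ∈ polyDegreeLT (K + 1) ↔ ∀ v : E, dirDeriv v f ∈ polyDegreeLT K := by
  simp [polyDegreeLT, Submodule.mem_iInf]

theorem polyDegreeLT_mono : Monotone (polyDegreeLT : ℕ → Submodule ℝ (SmoothMaps E F)) := by
  refine monotone_nat_of_le_succ fun K => ?_
  induction K with
  | zero => exact bot_le
  | succ K ih => exact fun f hf => mem_polyDegreeLT_succ.2 fun v => ih (mem_polyDegreeLT_succ.1 hf v)

theorem dirDeriv_mem_polyDegreeLT {K : ℕ} {f : SmoothMaps E F} (hf : f ∈ polyDegreeLT K) (v : E) :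
    dirDeriv v f ∈ polyDegreeLT K :=
  mem_polyDegreeLT_succ.1 (polyDegreeLT_mono K.le_succ hf) v

theorem mulInner_mem_polyDegreeLT {K : ℕ} {f : SmoothMaps E F} (hf : f ∈ polyDegreeLT K) (w : E) :
    mulInner w f ∈ polyDegreeLT (K + 1) := by
  induction K generalizing f with
  | zero =>
    obtain rfl : f = 0 := hf
    simp
  | succ K ih =>
    refine mem_polyDegreeLT_succ.2 fun v => ?_
    rw [← Module.End.mul_apply, dirDeriv_mul_mulInner, LinearMap.add_apply]
    exact add_mem (ih (mem_polyDegreeLT_succ.1 hf v)) (Submodule.smul_mem _ _ hf)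

theorem dirDeriv_pow_apply_eq_zero {K : ℕ} {f : SmoothMaps E F} (hf : f ∈ polyDegreeLT K) (v : E) :
    (dirDeriv v ^ K) f = 0 := by
  induction K generalizing f with
  | zero => exact hf
  | succ K ih =>
    rw [pow_succ, Module.End.mul_apply]
    exact ih (mem_polyDegreeLT_succ.1 hf v)

variable (E F) in
/-- The polynomial maps `E → F`. -/
noncomputable def polynomialMaps : Submodule ℝ (SmoothMaps E F) := ⨆ K, polyDegreeLT K

theorem mem_polynomialMaps {f : SmoothMaps E F} :
    f ∈ polynomialMaps E F ↔ ∃ K, f ∈ polyDegreeLT K :=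
  Submodule.mem_iSup_of_directed _ polyDegreeLT_mono.directed_le

theorem dirDeriv_mem_polynomialMaps {f : SmoothMaps E F} (hf : f ∈ polynomialMaps E F) (v : E) :
    dirDeriv v f ∈ polynomialMaps E F := by
  obtain ⟨K, hK⟩ := mem_polynomialMaps.1 hf
  exact mem_polynomialMaps.2 ⟨K, dirDeriv_mem_polyDegreeLT hK v⟩

theorem mulInner_mem_polynomialMaps {f : SmoothMaps E F} (hf : f ∈ polynomialMaps E F) (v : E) :
    mulInner v f ∈ polynomialMaps E F := by
  obtain ⟨K, hK⟩ := mem_polynomialMaps.1 hf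
  exact mem_polynomialMaps.2 ⟨_, mulInner_mem_polyDegreeLT hK v⟩

theorem dirDeriv_mul_mulInner_self {w : E} (hw : ‖w‖ = 1) :
    (dirDeriv w : Module.End ℝ (SmoothMaps E F)) * mulInner w = mulInner w * dirDeriv w + 1 := by
  rw [dirDeriv_mul_mulInner, real_inner_self_eq_norm_sq, hw, one_pow, one_smul]

/-- A polynomial map has a polynomial primitive in every unit direction. -/
theorem exists_dirDeriv_eq {w : E} (hw : ‖w‖ = 1) {q : SmoothMaps E F}
    (hq : q ∈ polynomialMaps E F) : ∃ y ∈ polynomialMaps E F, dirDeriv w y = q := by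
  obtain ⟨K, hK⟩ := mem_polynomialMaps.1 hq
  obtain ⟨Y, hY, hP, -⟩ := exists_antiderivative (P := polynomialMaps E F)
    (dirDeriv_mul_mulInner_self hw) (fun f hf => dirDeriv_mem_polynomialMaps hf w)
    (fun f hf => mulInner_mem_polynomialMaps hf w) (dirDeriv_pow_apply_eq_zero hK w)
  exact ⟨Y q, hP q hq, hY⟩

theorem SmoothMaps.hasDerivAt_comp_line (f : SmoothMaps E F) (x v : E) (t : ℝ) :
    HasDerivAt (fun s : ℝ => f.1 (x + s • v)) ((dirDeriv v f).1 (x + t • v)) t := by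
  have h1 : HasDerivAt (fun s : ℝ => x + s • v) v t := by
    simpa using ((hasDerivAt_id t).smul_const v).const_add x
  exact (SmoothMaps.differentiable f (x + t • v)).hasFDerivAt.comp_hasDerivAt t h1

/-- Taylor's formula for a map which is polynomial in the direction `v`. -/
theorem apply_add_smul_of_dirDeriv_pow_eq_zero {K : ℕ} {v : E} {f : SmoothMaps E F}
    (hf : (dirDeriv v ^ K) f = 0) (x : E) (t : ℝ) :
    f.1 (x + t • v) = ∑ i ∈ Finset.range K, (t ^ i / i.factorial) • ((dirDeriv v ^ i) f).1 x := by
  induction K generalizing f t with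
  | zero =>
    obtain rfl : f = 0 := hf
    simp
  | succ K ih =>
    set g : ℝ → F := fun t => f.1 (x + t • v) -
      ∑ i ∈ Finset.range (K + 1), (t ^ i / i.factorial) • ((dirDeriv v ^ i) f).1 x with hg
    have hd (s : ℝ) : HasDerivAt g 0 s := by
      have h1 := SmoothMaps.hasDerivAt_comp_line f x v s
      have h2 : HasDerivAt (fun t : ℝ => ∑ i ∈ Finset.range (K + 1),
          (t ^ i / i.factorial) • ((dirDeriv v ^ i) f).1 x)
          (∑ i ∈ Finset.range (K + 1),
            (((i : ℝ) * s ^ (i - 1)) / i.factorial) • ((dirDeriv v ^ i) f).1 x) s :=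
        HasDerivAt.fun_sum fun i _ => ((hasDerivAt_pow i s).div_const _).smul_const _
      have h3 : (dirDeriv v f).1 (x + s • v) = ∑ i ∈ Finset.range (K + 1),
            (((i : ℝ) * s ^ (i - 1)) / i.factorial) • ((dirDeriv v ^ i) f).1 x := by
        rw [ih (f := dirDeriv v f) (by rwa [pow_succ, Module.End.mul_apply] at hf),
          Finset.sum_range_succ']
        simp only [Nat.cast_zero, zero_mul, zero_div, zero_smul, add_zero]
        refine Finset.sum_congr rfl fun i _ => ?_
        rw [pow_succ (dirDeriv v), Module.End.mul_apply, Nat.factorial_succ]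
        congr 1
        have := Nat.factorial_ne_zero i
        push_cast
        field_simp
      have h4 := h1.sub h2
      rwa [h3, sub_self] at h4
    have hc := is_const_of_deriv_eq_zero (fun s => (hd s).differentiableAt) (fun s => (hd s).deriv) t 0
    have h0 : g 0 = 0 := by
      simp [hg, Finset.sum_range_succ']
    rw [h0] at hc
    exact sub_eq_zero.1 hc

variable [FiniteDimensional ℝ E]

theorem smoothLaplacian_sub_mem_polyDegreeLT {K : ℕ} {f : SmoothMaps E F}
    (hf : f ∈ polyDegreeLT (K + 1)) (w : E) :
    (smoothLaplacian - dirDeriv w ^ 2 : Module.End ℝ (SmoothMaps E F)) f ∈ polyDegreeLT K := by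
  have h (v : E) : (dirDeriv v ^ 2) f ∈ polyDegreeLT K := by
    rw [pow_two]
    exact dirDeriv_mem_polyDegreeLT (mem_polyDegreeLT_succ.1 hf v) v
  rw [LinearMap.sub_apply, smoothLaplacian, LinearMap.sum_apply]
  exact sub_mem (sum_mem fun i _ => h _) (h w)

theorem smoothLaplacian_mem_polynomialMaps {f : SmoothMaps E F} (hf : f ∈ polynomialMaps E F) :
    smoothLaplacian f ∈ polynomialMaps E F := by
  rw [smoothLaplacian, LinearMap.sum_apply]
  refine sum_mem fun i _ => ?_
  rw [pow_two]
  exact dirDeriv_mem_polynomialMaps (dirDeriv_mem_polynomialMaps hf _) _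

/-- `Δ - ∂_w²` lowers the degree, hence it is locally nilpotent on polynomial maps. -/
theorem smoothLaplacian_sub_pow_apply_eq_zero {K : ℕ} {f : SmoothMaps E F}
    (hf : f ∈ polyDegreeLT K) (w : E) :
    ((smoothLaplacian - dirDeriv w ^ 2 : Module.End ℝ (SmoothMaps E F)) ^ K) f = 0 := by
  induction K generalizing f with
  | zero => exact hf
  | succ K ih =>
    rw [pow_succ, Module.End.mul_apply]
    exact ih (smoothLaplacian_sub_mem_polyDegreeLT hf w)

/-- The Laplacian is onto on polynomial maps that do not depend on the direction `v`, as soon as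
there is a second direction `w` orthogonal to `v`. -/
theorem exists_smoothLaplacian_eq {v w : E} (hw : ‖w‖ = 1) (hvw : inner ℝ w v = 0)
    {q : SmoothMaps E F} (hq : q ∈ polynomialMaps E F) (hvq : dirDeriv v q = 0) :
    ∃ u ∈ polynomialMaps E F, dirDeriv v u = 0 ∧ smoothLaplacian u = q := by
  obtain ⟨K, hK⟩ := mem_polynomialMaps.1 hq
  refine exists_apply_eq_of_heisenberg (P := polynomialMaps E F) (dirDeriv_mul_mulInner_self hw)
    (smoothLaplacian_mul_mulInner w) (commute_dirDeriv_smoothLaplacian w) (dirDeriv_commute v w)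
    (by rw [commute_iff_eq, dirDeriv_mul_mulInner, hvw, zero_smul, add_zero])
    (commute_dirDeriv_smoothLaplacian v) (fun f hf => dirDeriv_mem_polynomialMaps hf w)
    (fun f hf => mulInner_mem_polynomialMaps hf w)
    (fun f hf => smoothLaplacian_mem_polynomialMaps hf) (fun f hf => ?_) K q hq hvq
    (smoothLaplacian_sub_pow_apply_eq_zero hK w)
  obtain ⟨N, hN⟩ := mem_polynomialMaps.1 hf
  exact ⟨N, dirDeriv_pow_apply_eq_zero hN w⟩

variable (E F) in
/-- The harmonic polynomial maps `E → F`. -/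
noncomputable def harmonicPolynomials : Submodule ℝ (SmoothMaps E F) :=
  LinearMap.ker smoothLaplacian ⊓ polynomialMaps E F

theorem mem_harmonicPolynomials {f : SmoothMaps E F} :
    f ∈ harmonicPolynomials E F ↔ smoothLaplacian f = 0 ∧ f ∈ polynomialMaps E F := Iff.rfl

/-- In dimension at least two, `∂_v` maps the harmonic polynomials onto themselves. -/
theorem exists_harmonicPolynomial_dirDeriv_eq (hdim : 2 ≤ Module.finrank ℝ E) {v : E} (hv : v ≠ 0)
    {q : SmoothMaps E F} (hq : q ∈ harmonicPolynomials E F) :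
    ∃ p ∈ harmonicPolynomials E F, dirDeriv v p = q := by
  wlog hv1 : ‖v‖ = 1 generalizing v
  · have hv0 : ‖v‖ ≠ 0 := norm_ne_zero_iff.2 hv
    obtain ⟨p, hp, hpq⟩ := this (v := ‖v‖⁻¹ • v) (by simp [hv]) (by simp [norm_smul, hv0])
    refine ⟨‖v‖⁻¹ • p, Submodule.smul_mem _ _ hp, ?_⟩
    rw [← hpq, dirDeriv_smul, map_smul, LinearMap.smul_apply]
  obtain ⟨w, hw, hwv⟩ : ∃ w : E, ‖w‖ = 1 ∧ inner ℝ w v = 0 := by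
    have h1 : (ℝ ∙ v)ᗮ ≠ ⊥ := by
      intro h
      have h2 := Submodule.finrank_add_finrank_orthogonal (ℝ ∙ v)
      rw [h, finrank_bot, finrank_span_singleton hv] at h2
      omega
    obtain ⟨w, hw, hw0⟩ := Submodule.exists_mem_ne_zero_of_ne_bot h1
    refine ⟨‖w‖⁻¹ • w, by simp [norm_smul, norm_ne_zero_iff.2 hw0], ?_⟩
    rw [real_inner_smul_left, real_inner_comm, Submodule.mem_orthogonal_singleton_iff_inner_right.1 hw,
      mul_zero]
  obtain ⟨p, hp, hpq⟩ := exists_dirDeriv_eq hv1 hq.2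
  obtain ⟨u, hu, hvu, huL⟩ := exists_smoothLaplacian_eq hw hwv
    (smoothLaplacian_mem_polynomialMaps hp) (by
      rw [← Module.End.mul_apply, (commute_dirDeriv_smoothLaplacian v).eq, Module.End.mul_apply, hpq]
      exact hq.1)
  refine ⟨p - u, mem_harmonicPolynomials.2 ⟨?_, sub_mem hp hu⟩, by rw [map_sub, hpq, hvu, sub_zero]⟩
  rw [map_sub, huL, sub_self]

end Polynomial

/-! ### Mean value property and gradient estimate -/

section MeanValue

open MeasureTheory Filter Topology

variable {E F : Type*} [NormedAddCommGroup E]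

/-- A smooth radial bump function supported in the closed unit ball. -/
noncomputable def radialBump (x : E) : ℝ := Real.smoothTransition (1 - ‖x‖ ^ 2)

/-- The radial weight `ψ` with `∇Ψ = -ψ x`, where `Ψ` is `radialBump`. -/
noncomputable def radialWeight (x : E) : ℝ := 2 * deriv Real.smoothTransition (1 - ‖x‖ ^ 2)

theorem radialBump_nonneg (x : E) : 0 ≤ radialBump x := Real.smoothTransition.nonneg _

theorem radialWeight_nonneg (x : E) : 0 ≤ radialWeight x :=
  mul_nonneg zero_le_two Real.smoothTransition.monotone.deriv_nonneg

theorem radialWeight_neg (x : E) : radialWeight (-x) = radialWeight x := by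
  simp [radialWeight]

theorem radialBump_zero : radialBump (0 : E) = 1 := by simp [radialBump]

theorem support_radialBump_subset :
    Function.support (radialBump : E → ℝ) ⊆ Metric.closedBall 0 1 := by
  intro x hx
  by_contra h
  rw [mem_closedBall_zero_iff, not_le] at h
  exact hx (Real.smoothTransition.zero_of_nonpos (by nlinarith))

theorem support_radialWeight_subset :
    Function.support (radialWeight : E → ℝ) ⊆ Metric.closedBall 0 1 := by
  intro x hx
  by_contra h
  rw [mem_closedBall_zero_iff, not_le] at h
  refine hx ?_
  have h1 : 1 - ‖x‖ ^ 2 < 0 := by nlinarith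
  have h2 : Real.smoothTransition =ᶠ[𝓝 (1 - ‖x‖ ^ 2)] fun _ => 0 := by
    filter_upwards [Iio_mem_nhds h1] with s hs
    exact Real.smoothTransition.zero_of_nonpos (le_of_lt hs)
  simp [radialWeight, h2.deriv_eq]

variable [InnerProductSpace ℝ E] [NormedAddCommGroup F] [NormedSpace ℝ F]

theorem contDiff_radialBump : ContDiff ℝ ∞ (radialBump : E → ℝ) :=
  Real.smoothTransition.contDiff.comp (contDiff_const.sub (contDiff_norm_sq ℝ))

theorem contDiff_radialWeight : ContDiff ℝ ∞ (radialWeight : E → ℝ) := by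
  have h : ContDiff ℝ ∞ (deriv Real.smoothTransition) :=
    ((contDiff_succ_iff_deriv (n := ∞)).1 (Real.smoothTransition.contDiff (n := ⊤))).2.2
  exact contDiff_const.mul (h.comp (contDiff_const.sub (contDiff_norm_sq ℝ)))

theorem fderiv_radialBump_apply (x v : E) :
    fderiv ℝ radialBump x v = -(inner ℝ x v * radialWeight x) := by
  have h1 : HasFDerivAt (fun x : E => 1 - ‖x‖ ^ 2) (-(2 • innerSL ℝ x)) x :=
    ((hasStrictFDerivAt_norm_sq x).hasFDerivAt).const_sub 1
  have h2 : HasDerivAt Real.smoothTransition (deriv Real.smoothTransition (1 - ‖x‖ ^ 2))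
      (1 - ‖x‖ ^ 2) :=
    ((Real.smoothTransition.contDiff (n := 1)).differentiable (by simp) _).hasDerivAt
  have h3 := h2.comp_hasFDerivAt x h1
  have h4 : fderiv ℝ (radialBump : E → ℝ) x = _ := h3.fderiv
  rw [h4]
  simp [radialWeight]
  ring

theorem hasFDerivAt_comp_affine (f : SmoothMaps E F) (y : E) (s : ℝ) (x : E) :
    HasFDerivAt (fun x => f.1 (y + s • x)) (s • fderiv ℝ f.1 (y + s • x)) x := by
  have h1 : HasFDerivAt (fun x : E => y + s • x) (s • ContinuousLinearMap.id ℝ E) x :=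
    ((hasFDerivAt_id x).const_smul s).const_add y
  have h2 := (SmoothMaps.differentiable f (y + s • x)).hasFDerivAt.comp x h1
  rwa [ContinuousLinearMap.comp_smul, ContinuousLinearMap.comp_id] at h2

variable [FiniteDimensional ℝ E]

theorem hasCompactSupport_radialBump : HasCompactSupport (radialBump : E → ℝ) :=
  HasCompactSupport.of_support_subset_isCompact (isCompact_closedBall 0 1) support_radialBump_subset

theorem hasCompactSupport_radialWeight : HasCompactSupport (radialWeight : E → ℝ) :=
  HasCompactSupport.of_support_subset_isCompact (isCompact_closedBall 0 1)
    support_radialWeight_subset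

variable [MeasurableSpace E] [BorelSpace E]

theorem integral_radialBump_pos : 0 < ∫ x : E, radialBump x :=
  contDiff_radialBump.continuous.integral_pos_of_hasCompactSupport_nonneg_nonzero
    hasCompactSupport_radialBump radialBump_nonneg (x := 0) (by simp [radialBump_zero])

theorem integral_radialWeight_pos [Nontrivial E] : 0 < ∫ x : E, radialWeight x := by
  -- Otherwise the radial bump would have zero gradient, but it is not constant.
  obtain ⟨x, hx⟩ : ∃ x : E, radialWeight x ≠ 0 := by
    by_contra! h
    obtain ⟨y, hy⟩ := exists_norm_eq E zero_le_one
    have h1 := is_const_of_fderiv_eq_zero (contDiff_radialBump.differentiable (by simp))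
      (fun x : E => by ext v; simp [fderiv_radialBump_apply, h]) 0 y
    rw [radialBump_zero, radialBump, hy] at h1
    simp at h1
  exact contDiff_radialWeight.continuous.integral_pos_of_hasCompactSupport_nonneg_nonzero
    hasCompactSupport_radialWeight radialWeight_nonneg hx

theorem integrable_smul_of_hasCompactSupport {χ : E → ℝ} (hχ : Continuous χ)
    (hs : HasCompactSupport χ) {g : E → F} (hg : Continuous g) :
    Integrable (fun x => χ x • g x) :=
  (hχ.smul hg).integrable_of_hasCompactSupport hs.smul_right

/-- Integration by parts against a test function. -/
theorem integral_fderiv_smul_comp {χ : E → ℝ} (hχ : ContDiff ℝ ∞ χ) (hs : HasCompactSupport χ)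
    (f : SmoothMaps E F) (v y : E) (s : ℝ) :
    ∫ x, fderiv ℝ χ x v • f.1 (y + s • x) =
      -(s • ∫ x, χ x • (dirDeriv v f).1 (y + s • x)) := by
  have hc : Continuous fun x : E => y + s • x := by fun_prop
  have hd (x : E) := hasFDerivAt_comp_affine f y s x
  have hχ' : Continuous fun x => fderiv ℝ χ x v := (hχ.fderiv_apply_const v).continuous
  have hsχ' : HasCompactSupport fun x => fderiv ℝ χ x v := hs.fderiv_apply ℝ v
  have h := integral_smul_fderiv_eq_neg_fderiv_smul_of_integrable (μ := (volume : Measure E))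
    (f := χ) (g := fun x => f.1 (y + s • x)) (v := v)
    (integrable_smul_of_hasCompactSupport hχ' hsχ' ((SmoothMaps.continuous f).comp hc))
    (by
      simp only [fun x => (hd x).fderiv]
      exact integrable_smul_of_hasCompactSupport hχ.continuous hs
        (((SmoothMaps.continuous (dirDeriv v f)).comp hc).const_smul s))
    (integrable_smul_of_hasCompactSupport hχ.continuous hs ((SmoothMaps.continuous f).comp hc))
    (fun x _ => hχ.differentiable (by simp) x) (fun x _ => (hd x).differentiableAt)
  rw [← neg_eq_iff_eq_neg, ← h, ← integral_smul]
  refine integral_congr_ae (ae_of_all _ fun x => ?_)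
  simp only [(hd x).fderiv]
  rw [smul_comm s]
  rfl

theorem hasDerivAt_integral_smul_comp {χ : E → ℝ} (hχ : Continuous χ) (hs : HasCompactSupport χ)
    (f : SmoothMaps E F) (y : E) (s : ℝ) :
    HasDerivAt (fun s : ℝ => ∫ x, χ x • f.1 (y + s • x))
      (∫ x, χ x • fderiv ℝ f.1 (y + s • x) x) s := by
  have hf' : Continuous (fderiv ℝ f.1) := (SmoothMaps.contDiff f).continuous_fderiv (by simp)
  have hcont : Continuous fun p : ℝ × E => fderiv ℝ f.1 (y + p.1 • p.2) p.2 :=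
    (hf'.comp (by fun_prop)).clm_apply continuous_snd
  obtain ⟨C, hC⟩ := ((isCompact_closedBall s 1).prod hs).exists_bound_of_continuousOn
    hcont.continuousOn
  have hF (s : ℝ) : Integrable fun x => χ x • f.1 (y + s • x) :=
    integrable_smul_of_hasCompactSupport hχ hs ((SmoothMaps.continuous f).comp (by fun_prop))
  refine (hasDerivAt_integral_of_dominated_loc_of_deriv_le (bound := fun x => ‖χ x‖ * C)
    (Metric.closedBall_mem_nhds s one_pos)
    (Eventually.of_forall fun s => (hF s).aestronglyMeasurable) (hF s)
    (F' := fun s x => χ x • fderiv ℝ f.1 (y + s • x) x)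
    ((hχ.smul (hcont.comp (by fun_prop : Continuous fun x : E => (s, x)))).aestronglyMeasurable)
    (ae_of_all _ fun x r hr => ?_) ?_ (ae_of_all _ fun x r hr => ?_)).2
  · rw [norm_smul]
    by_cases hx : x ∈ tsupport χ
    · exact mul_le_mul_of_nonneg_left (hC (r, x) ⟨hr, hx⟩) (norm_nonneg _)
    · simp [image_eq_zero_of_notMem_tsupport hx]
  · exact (hχ.norm.integrable_of_hasCompactSupport hs.norm).mul_const C
  · have h1 : HasDerivAt (fun r : ℝ => y + r • x) x r := by
      simpa using ((hasDerivAt_id r).smul_const x).const_add y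
    exact ((SmoothMaps.differentiable f _).hasFDerivAt.comp_hasDerivAt r h1).const_smul (χ x)

/-- The derivative of a radial mean of a smooth map is a radial mean of its Laplacian. -/
theorem hasDerivAt_radialMean (f : SmoothMaps E F) (y : E) (s : ℝ) :
    HasDerivAt (fun s : ℝ => ∫ x, radialWeight x • f.1 (y + s • x))
      (s • ∫ x, radialBump x • (smoothLaplacian f).1 (y + s • x)) s := by
  convert hasDerivAt_integral_smul_comp contDiff_radialWeight.continuous
    hasCompactSupport_radialWeight f y s using 1
  have hc : Continuous fun x : E => y + s • x := by fun_prop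
  set b := stdOrthonormalBasis ℝ E
  have h1 (x : E) : radialWeight x • fderiv ℝ f.1 (y + s • x) x =
      ∑ i, -(fderiv ℝ radialBump x (b i) • (dirDeriv (b i) f).1 (y + s • x)) := by
    conv_lhs => enter [2]; arg 2; rw [← b.sum_repr' x]
    rw [map_sum, Finset.smul_sum]
    refine Finset.sum_congr rfl fun i _ => ?_
    rw [fderiv_radialBump_apply, map_smul, neg_smul, neg_neg, smul_smul, real_inner_comm, mul_comm]
    rfl
  have h2 (x : E) : radialBump x • (smoothLaplacian f).1 (y + s • x) =
      ∑ i, radialBump x • (dirDeriv (b i) (dirDeriv (b i) f)).1 (y + s • x) := by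
    rw [← Finset.smul_sum]
    simp [smoothLaplacian, pow_two, LinearMap.sum_apply, b]
  simp only [h1, h2]
  rw [integral_finsetSum, integral_finsetSum, Finset.smul_sum]
  · refine Finset.sum_congr rfl fun i _ => ?_
    rw [integral_neg, integral_fderiv_smul_comp contDiff_radialBump hasCompactSupport_radialBump,
      neg_neg]
  · intro i _
    exact (integrable_smul_of_hasCompactSupport
      ((contDiff_radialBump.fderiv_apply_const (b i)).continuous)
      (hasCompactSupport_radialBump.fderiv_apply ℝ (b i))
      ((SmoothMaps.continuous (dirDeriv (b i) f)).comp hc)).neg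
  · intro i _
    exact integrable_smul_of_hasCompactSupport contDiff_radialBump.continuous
      hasCompactSupport_radialBump
      ((SmoothMaps.continuous (dirDeriv (b i) (dirDeriv (b i) f))).comp hc)

/-- The mean value property of smooth harmonic maps. -/
theorem radialMean_eq [CompleteSpace F] {f : SmoothMaps E F} (hf : smoothLaplacian f = 0) (y : E)
    (s : ℝ) :
    ∫ x, radialWeight x • f.1 (y + s • x) = (∫ x : E, radialWeight x) • f.1 y := by
  have h (s : ℝ) : HasDerivAt (fun s : ℝ => ∫ x, radialWeight x • f.1 (y + s • x)) 0 s := by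
    convert hasDerivAt_radialMean f y s using 1
    simp [hf]
  have := is_const_of_deriv_eq_zero (fun s => (h s).differentiableAt) (fun s => (h s).deriv) s 0
  rw [this]
  simp [integral_smul_const]

/-- The converse of the mean value property, for smooth maps. -/
theorem smoothLaplacian_eq_zero_of_radialMean [CompleteSpace F] {f : SmoothMaps E F}
    (hf : ∀ (y : E) (s : ℝ),
      ∫ x, radialWeight x • f.1 (y + s • x) = (∫ x : E, radialWeight x) • f.1 y) :
    smoothLaplacian f = 0 := by
  ext y
  -- The radial mean of `Δ f` over balls of radius `s` vanishes for `s ≠ 0`; let `s → 0`.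
  set G : ℝ → F := fun s => ∫ x, radialBump x • (smoothLaplacian f).1 (y + s • x) with hG
  have hGc : Continuous G := continuous_iff_continuousAt.2 fun s =>
    (hasDerivAt_integral_smul_comp contDiff_radialBump.continuous hasCompactSupport_radialBump
      (smoothLaplacian f) y s).continuousAt
  have hG0 : G = fun _ => 0 := by
    refine hGc.ext_on (dense_compl_singleton (0 : ℝ)) continuous_const fun s hs => ?_
    have h1 := hasDerivAt_radialMean f y s
    simp only [hf] at h1
    exact (smul_eq_zero.1 (h1.unique (hasDerivAt_const s _))).resolve_left hs
  have h0 := congrFun hG0 0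
  simp only [hG, zero_smul, add_zero, integral_smul_const] at h0
  exact (smul_eq_zero.1 h0).resolve_left integral_radialBump_pos.ne'

/-- Weyl's lemma in its simplest form: the mean value property alone gives smoothness. -/
theorem contDiff_of_radialMean [Nontrivial E] {f : E → F} (hf : Continuous f)
    (h : ∀ y : E, ∫ x, radialWeight x • f (y + x) = (∫ x : E, radialWeight x) • f y) :
    ContDiff ℝ ∞ f := by
  set c : ℝ := ∫ x : E, radialWeight x with hc
  -- `f` is, up to a constant, its convolution with the smooth radial weight.
  have h1 : ContDiff ℝ ∞ (convolution f radialWeight (ContinuousLinearMap.lsmul ℝ ℝ).flip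
      (volume : Measure E)) :=
    hasCompactSupport_radialWeight.contDiff_convolution_right _ hf.locallyIntegrable
      contDiff_radialWeight
  convert h1.const_smul c⁻¹ using 1
  ext y
  have h2 := integral_add_left_eq_self (μ := (volume : Measure E))
    (fun t => radialWeight (y - t) • f t) y
  simp only [sub_add_cancel_left, radialWeight_neg] at h2
  rw [h] at h2
  rw [convolution_def, eq_inv_smul_iff₀ integral_radialWeight_pos.ne', h2]
  simp

theorem integrable_norm_fderiv {χ : E → ℝ} (hχ : ContDiff ℝ ∞ χ) (hs : HasCompactSupport χ) :
    Integrable (fun x => ‖fderiv ℝ χ x‖) := by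
  have h1 : Continuous fun x => ‖fderiv ℝ χ x‖ := (hχ.continuous_fderiv (by simp)).norm
  have h2 : HasCompactSupport fun x => ‖fderiv ℝ χ x‖ := (hs.fderiv ℝ).norm
  exact h1.integrable_of_hasCompactSupport h2

/-- The gradient estimate for harmonic maps. -/
theorem exists_norm_dirDeriv_le [CompleteSpace F] [Nontrivial E] :
    ∃ C : ℝ, 0 ≤ C ∧ ∀ (f : SmoothMaps E F), smoothLaplacian f = 0 → ∀ (v y : E) (r A : ℝ), 0 < r →
      (∀ z ∈ Metric.closedBall y r, ‖f.1 z‖ ≤ A) → ‖(dirDeriv v f).1 y‖ ≤ C * ‖v‖ / r * A := by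
  obtain ⟨c, hc⟩ : ∃ c : ℝ, c = ∫ x : E, radialWeight x := ⟨_, rfl⟩
  have hc0 : 0 < c := hc ▸ integral_radialWeight_pos
  have hint := integrable_norm_fderiv (E := E) contDiff_radialWeight hasCompactSupport_radialWeight
  obtain ⟨I, hI⟩ : ∃ I : ℝ, I = ∫ x : E, ‖fderiv ℝ radialWeight x‖ := ⟨_, rfl⟩
  have hI0 : 0 ≤ I := hI ▸ integral_nonneg fun _ => norm_nonneg _
  refine ⟨c⁻¹ * I, by positivity, fun f hf v y r A hr hA => ?_⟩
  -- Apply the mean value property to the harmonic map `∂_v f` and integrate by parts.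
  have hDf : smoothLaplacian (dirDeriv v f) = 0 := by
    rw [← Module.End.mul_apply, ← (commute_dirDeriv_smoothLaplacian v).eq, Module.End.mul_apply, hf,
      map_zero]
  have h1 := integral_fderiv_smul_comp contDiff_radialWeight hasCompactSupport_radialWeight f v y r
  rw [radialMean_eq hDf, ← hc, smul_smul] at h1
  have h2 : ‖∫ x, fderiv ℝ radialWeight x v • f.1 (y + r • x)‖ ≤
      ∫ x : E, ‖fderiv ℝ radialWeight x‖ * (‖v‖ * A) := by
    refine norm_integral_le_of_norm_le (hint.mul_const _) (ae_of_all _ fun x => ?_)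
    by_cases hx : x ∈ Metric.closedBall (0 : E) 1
    · rw [norm_smul, ← mul_assoc]
      refine mul_le_mul (ContinuousLinearMap.le_opNorm _ _) (hA _ ?_) (norm_nonneg _)
        (by positivity)
      rw [mem_closedBall_zero_iff] at hx
      simpa [norm_smul, abs_of_pos hr] using mul_le_of_le_one_right hr.le hx
    · have h3 : fderiv ℝ radialWeight x = 0 := by
        by_contra h
        exact hx (closure_minimal support_radialWeight_subset Metric.isClosed_closedBall
          (support_fderiv_subset ℝ h))
      simp [h3]
  rw [h1, norm_neg, norm_smul, Real.norm_of_nonneg (by positivity), integral_mul_const, ← hI] at h2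
  calc ‖(dirDeriv v f).1 y‖ = (r * c)⁻¹ * (r * c * ‖(dirDeriv v f).1 y‖) := by
        field_simp
    _ ≤ (r * c)⁻¹ * (I * (‖v‖ * A)) := by gcongr
    _ = c⁻¹ * I * ‖v‖ / r * A := by field_simp

end MeanValue

/-! ### Taylor expansion of harmonic maps -/

section Taylor

open Filter Topology

variable {E F : Type*} [NormedAddCommGroup E] [InnerProductSpace ℝ E]
  [NormedAddCommGroup F] [NormedSpace ℝ F] [FiniteDimensional ℝ E]

/-- The homogeneous part of degree `j` of the Taylor series at the origin, given recursively by
Euler's identity `j P = ∑ x_i ∂_i P`. -/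
noncomputable def taylorPart : ℕ → Module.End ℝ (SmoothMaps E F)
  | 0 =>
    { toFun := fun f => ⟨fun _ => f.1 0, contDiff_const (𝕜 := ℝ) (n := ∞)⟩
      map_add' := fun _ _ => rfl
      map_smul' := fun _ _ => rfl }
  | j + 1 => ((j : ℝ) + 1)⁻¹ • ∑ i, mulInner (stdOrthonormalBasis ℝ E i) *
      taylorPart j * dirDeriv (stdOrthonormalBasis ℝ E i)

theorem dirDeriv_mul_taylorPart_zero (v : E) :
    (dirDeriv v : Module.End ℝ (SmoothMaps E F)) * taylorPart 0 = 0 := by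
  ext f x
  change fderiv ℝ (fun _ => f.1 0) x v = 0
  simp

theorem dirDeriv_mul_taylorPart_succ (v : E) (j : ℕ) :
    (dirDeriv v : Module.End ℝ (SmoothMaps E F)) * taylorPart (j + 1) =
      taylorPart j * dirDeriv v := by
  have key (j : ℕ) : (dirDeriv v : Module.End ℝ (SmoothMaps E F)) * taylorPart (j + 1) =
      ((j : ℝ) + 1)⁻¹ • (∑ i, mulInner (stdOrthonormalBasis ℝ E i) *
        (dirDeriv v * taylorPart j) * dirDeriv (stdOrthonormalBasis ℝ E i) +
        taylorPart j * dirDeriv v) := by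
    rw [taylorPart, mul_smul_comm, Finset.mul_sum, ← sum_inner_smul_dirDeriv v, Finset.mul_sum,
      ← Finset.sum_add_distrib]
    congr 1
    refine Finset.sum_congr rfl fun i _ => ?_
    rw [sum_inner_smul_dirDeriv, ← mul_assoc, ← mul_assoc, dirDeriv_mul_mulInner, add_mul, add_mul,
      ← mul_assoc, smul_mul_assoc, one_mul, smul_mul_assoc, mul_smul_comm]
  induction j with
  | zero => simp [key, dirDeriv_mul_taylorPart_zero]
  | succ j ih =>
    rw [key, ih]
    have h1 : ∑ i, mulInner (stdOrthonormalBasis ℝ E i) * (taylorPart j * dirDeriv v) *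
        dirDeriv (stdOrthonormalBasis ℝ E i) =
        ((j : ℝ) + 1) • ((taylorPart (j + 1) : Module.End ℝ (SmoothMaps E F)) * dirDeriv v) := by
      rw [taylorPart, smul_mul_assoc, smul_smul, mul_inv_cancel₀ (by positivity), one_smul,
        Finset.sum_mul]
      refine Finset.sum_congr rfl fun i _ => ?_
      simp only [mul_assoc]
      rw [(dirDeriv_commute v _).eq]
    rw [h1, Nat.cast_succ]
    have h2 : ((j : ℝ) + 1 + 1) ≠ 0 := by positivity
    rw [inv_smul_eq_iff₀ h2, add_smul ((j : ℝ) + 1) (1 : ℝ), one_smul]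

theorem taylorPart_mem_polyDegreeLT (j : ℕ) (f : SmoothMaps E F) :
    taylorPart j f ∈ polyDegreeLT (j + 1) := by
  induction j generalizing f with
  | zero =>
    refine mem_polyDegreeLT_succ.2 fun v => ?_
    rw [← Module.End.mul_apply, dirDeriv_mul_taylorPart_zero]
    exact zero_mem _
  | succ j ih =>
    refine mem_polyDegreeLT_succ.2 fun v => ?_
    rw [← Module.End.mul_apply, dirDeriv_mul_taylorPart_succ]
    exact ih _

theorem smoothLaplacian_taylorPart {f : SmoothMaps E F} (hf : smoothLaplacian f = 0) (j : ℕ) :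
    smoothLaplacian (taylorPart j f) = 0 := by
  have h0 : ∀ v : E, ∀ g : SmoothMaps E F, dirDeriv v (taylorPart 0 g) = 0 := fun v g => by
    rw [← Module.End.mul_apply, dirDeriv_mul_taylorPart_zero, LinearMap.zero_apply]
  have h1 : ∀ (j : ℕ) (v : E) (g : SmoothMaps E F),
      dirDeriv v (taylorPart (j + 1) g) = taylorPart j (dirDeriv v g) := fun j v g => by
    rw [← Module.End.mul_apply, dirDeriv_mul_taylorPart_succ, Module.End.mul_apply]
  simp only [smoothLaplacian, LinearMap.sum_apply, pow_two, Module.End.mul_apply] at hf ⊢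
  match j with
  | 0 => simp [h0]
  | 1 => simp [h0, h1]
  | j + 2 => simp only [h1, ← map_sum, hf, map_zero]

theorem taylorPart_mem_harmonicPolynomials {f : SmoothMaps E F} (hf : smoothLaplacian f = 0)
    (j : ℕ) : taylorPart j f ∈ harmonicPolynomials E F :=
  mem_harmonicPolynomials.2 ⟨smoothLaplacian_taylorPart hf j,
    mem_polynomialMaps.2 ⟨_, taylorPart_mem_polyDegreeLT j f⟩⟩

theorem taylorPart_succ_apply_zero (j : ℕ) (f : SmoothMaps E F) :
    (taylorPart (j + 1) f).1 0 = 0 := by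
  simp [taylorPart, LinearMap.sum_apply, mulInner_apply]

/-- The remainder of order `k` of the Taylor series at the origin. -/
noncomputable def taylorRem (k : ℕ) (f : SmoothMaps E F) : SmoothMaps E F :=
  f - ∑ j ∈ Finset.range k, taylorPart j f

theorem dirDeriv_taylorRem_succ (v : E) (k : ℕ) (f : SmoothMaps E F) :
    dirDeriv v (taylorRem (k + 1) f) = taylorRem k (dirDeriv v f) := by
  simp only [taylorRem, map_sub, map_sum, Finset.sum_range_succ', map_add]
  simp only [← Module.End.mul_apply, dirDeriv_mul_taylorPart_zero, dirDeriv_mul_taylorPart_succ,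
    LinearMap.zero_apply, add_zero]

theorem taylorRem_succ_apply_zero (k : ℕ) (f : SmoothMaps E F) : (taylorRem (k + 1) f).1 0 = 0 := by
  simp only [taylorRem, Finset.sum_range_succ', Submodule.coe_sub, Submodule.coe_add,
    Submodule.coe_sum, Pi.sub_apply, Pi.add_apply, Finset.sum_apply, taylorPart_succ_apply_zero,
    Finset.sum_const_zero, zero_add]
  exact sub_self _

/-- The integral-free form of Taylor's estimate, by induction along the ray through `x`. -/
theorem norm_taylorRem_le {x : E} (k : ℕ) {f : SmoothMaps E F} {A : ℝ}
    (hA : ∀ t ∈ Set.Icc (0 : ℝ) 1, ‖((dirDeriv x ^ k) f).1 (t • x)‖ ≤ A) :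
    ∀ t ∈ Set.Icc (0 : ℝ) 1, ‖(taylorRem k f).1 (t • x)‖ ≤ A * (t ^ k / k.factorial) := by
  induction k generalizing f with
  | zero =>
    intro t ht
    simpa [taylorRem] using hA t ht
  | succ k ih =>
    have h1 := ih (f := dirDeriv x f) (by simpa only [pow_succ, Module.End.mul_apply] using hA)
    have hd (t : ℝ) : HasDerivAt (fun t : ℝ => (taylorRem (k + 1) f).1 (t • x))
        ((taylorRem k (dirDeriv x f)).1 (t • x)) t := by
      simpa [dirDeriv_taylorRem_succ] using
        SmoothMaps.hasDerivAt_comp_line (taylorRem (k + 1) f) 0 x t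
    have hB (t : ℝ) : HasDerivAt (fun t : ℝ => A * (t ^ (k + 1) / (k + 1).factorial))
        (A * (t ^ k / k.factorial)) t := by
      refine (((hasDerivAt_pow (k + 1) t).div_const
        ((k + 1).factorial : ℝ)).const_mul A).congr_deriv ?_
      have := Nat.factorial_ne_zero k
      rw [Nat.factorial_succ]
      push_cast
      field_simp
    intro t ht
    exact image_norm_le_of_norm_deriv_right_le_deriv_boundary
      (fun t _ => (hd t).continuousAt.continuousWithinAt)
      (fun t _ => (hd t).hasDerivWithinAt) (by simp [taylorRem_succ_apply_zero]) hB
      (fun t ht => h1 t ⟨ht.1, ht.2.le⟩) ht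

theorem smoothLaplacian_dirDeriv_eq_zero {f : SmoothMaps E F} (hf : smoothLaplacian f = 0) (v : E) :
    smoothLaplacian (dirDeriv v f) = 0 := by
  rw [← Module.End.mul_apply, ← (commute_dirDeriv_smoothLaplacian v).eq, Module.End.mul_apply, hf,
    map_zero]

/-- A harmonic map is, on each ball, a uniform limit of harmonic polynomials: its Taylor
polynomials, by the derivative estimates. -/
theorem exists_harmonicPolynomial_norm_sub_le [MeasurableSpace E] [BorelSpace E] [CompleteSpace F]
    [Nontrivial E] {f : SmoothMaps E F} (hf : smoothLaplacian f = 0) {R ε : ℝ} (hR : 0 < R)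
    (hε : 0 < ε) :
    ∃ p ∈ harmonicPolynomials E F, ∀ x ∈ Metric.closedBall (0 : E) R, ‖f.1 x - p.1 x‖ ≤ ε := by
  obtain ⟨C, hC0, hC⟩ := exists_norm_dirDeriv_le (E := E) (F := F)
  -- The gradient estimate on balls of radius `r`, applied `k` times.
  have hiter (v : E) {r : ℝ} (hr : 0 < r) (k : ℕ) : ∀ (f : SmoothMaps E F),
      smoothLaplacian f = 0 → ∀ (A : ℝ) (y : E), (∀ z ∈ Metric.closedBall y (k * r), ‖f.1 z‖ ≤ A) →
        ‖((dirDeriv v ^ k) f).1 y‖ ≤ (C * ‖v‖ / r) ^ k * A := by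
    induction k with
    | zero => intro f _ A y h; simpa using h y (by simp)
    | succ k ih =>
      intro f hf A y h
      rw [pow_succ, Module.End.mul_apply, pow_succ, mul_assoc]
      refine ih _ (smoothLaplacian_dirDeriv_eq_zero hf v) _ y fun z hz =>
        hC f hf v z r A hr fun u hu => h u ?_
      rw [Metric.mem_closedBall] at hz hu ⊢
      push_cast
      linarith [dist_triangle u z y]
  -- With steps of length `ρ / k` the remainder of order `k` is at most `(C R e / ρ)^k A`, because
  -- `k^k / k! ≤ e^k`; this `ρ` makes the ratio at most `1 / 2`.
  set ρ : ℝ := 2 * (C * R * Real.exp 1) + 1 with hρ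
  have hρ0 : 0 < ρ := by positivity
  obtain ⟨A, hA⟩ := (isCompact_closedBall (0 : E) (R + ρ)).exists_bound_of_continuousOn
    (SmoothMaps.continuous f).continuousOn
  have hA0 : 0 ≤ A := (norm_nonneg _).trans (hA 0 (by simp; positivity))
  have hlim : Tendsto (fun k : ℕ => (1 / 2 : ℝ) ^ k * A) atTop (𝓝 0) := by
    simpa using (tendsto_pow_atTop_nhds_zero_of_lt_one (by norm_num : (0 : ℝ) ≤ 1 / 2)
      (by norm_num)).mul_const A
  obtain ⟨k, hk, hk1⟩ := ((hlim.eventually_le_const hε).and (eventually_ge_atTop 1)).exists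
  refine ⟨∑ j ∈ Finset.range k, taylorPart j f,
    sum_mem fun j _ => taylorPart_mem_harmonicPolynomials hf j, fun x hx => le_trans ?_ hk⟩
  rw [mem_closedBall_zero_iff] at hx
  have hk0 : (0 : ℝ) < k := by exact_mod_cast hk1
  have h1 := norm_taylorRem_le (x := x) k (f := f) (A := (C * ‖x‖ / (ρ / k)) ^ k * A)
    (fun t ht => hiter x (div_pos hρ0 hk0) k f hf A (t • x) fun z hz => hA z ?_) 1 (by simp)
  · rw [one_smul, one_pow] at h1
    refine h1.trans ?_
    have h2 := Real.pow_div_factorial_le_exp (k : ℝ) hk0.le k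
    calc (C * ‖x‖ / (ρ / k)) ^ k * A * (1 / k.factorial)
        = (C * ‖x‖ / ρ) ^ k * ((k : ℝ) ^ k / k.factorial) * A := by
          rw [show C * ‖x‖ / (ρ / k) = C * ‖x‖ / ρ * k by field_simp, mul_pow]; ring
      _ ≤ (C * R / ρ) ^ k * Real.exp k * A := by gcongr
      _ = (C * R * Real.exp 1 / ρ) ^ k * A := by
          rw [← mul_one (k : ℝ), Real.exp_nat_mul, ← mul_pow]; congr 2; ring
      _ ≤ (1 / 2) ^ k * A := by
          have : C * R * Real.exp 1 / ρ ≤ 1 / 2 := by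
            rw [div_le_iff₀ hρ0, hρ]; linarith
          gcongr
  · rw [mem_closedBall_zero_iff]
    rw [mem_closedBall_iff_norm, mul_div_cancel₀ _ hk0.ne'] at hz
    have h3 : ‖t • x‖ ≤ R := by
      rw [norm_smul, Real.norm_of_nonneg ht.1]
      exact (mul_le_of_le_one_left (norm_nonneg x) ht.2).trans hx
    calc ‖z‖ = ‖(z - t • x) + t • x‖ := by rw [sub_add_cancel]
      _ ≤ R + ρ := by linarith [norm_add_le (z - t • x) (t • x)]

end Taylor

/-! ### The space of harmonic maps -/

section Closed

open MeasureTheory Filter Topology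

variable {E F : Type*} [NormedAddCommGroup E] [InnerProductSpace ℝ E]
  [NormedAddCommGroup F] [NormedSpace ℝ F] [FiniteDimensional ℝ E]

theorem continuous_radialMean [MeasurableSpace E] [BorelSpace E] (y : E) (s : ℝ) :
    Continuous fun f : C(E, F) => ∫ x, radialWeight x • f (y + s • x) := by
  refine continuous_iff_continuousAt.2 fun f => Metric.tendsto_nhds.2 fun ε hε => ?_
  obtain ⟨c, hc⟩ : ∃ c : ℝ, c = ∫ x : E, radialWeight x := ⟨_, rfl⟩
  have hc0 : 0 ≤ c := hc ▸ integral_nonneg radialWeight_nonneg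
  have hδ : 0 < ε / (c + 1) := by positivity
  have h1 := Metric.tendstoUniformlyOn_iff.1
    (ContinuousMap.tendsto_iff_forall_isCompact_tendstoUniformlyOn.1 (tendsto_id (x := 𝓝 f))
      (Metric.closedBall y |s|) (isCompact_closedBall _ _)) _ hδ
  have hint (g : C(E, F)) : Integrable fun x => radialWeight x • g (y + s • x) :=
    integrable_smul_of_hasCompactSupport contDiff_radialWeight.continuous
      hasCompactSupport_radialWeight (by fun_prop)
  filter_upwards [h1] with g hg
  rw [dist_eq_norm, ← integral_sub (hint g) (hint f)]
  have h2 : ‖∫ x, (radialWeight x • g (y + s • x) - radialWeight x • f (y + s • x))‖ ≤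
      ∫ x : E, radialWeight x * (ε / (c + 1)) := by
    refine norm_integral_le_of_norm_le
      ((contDiff_radialWeight.continuous.integrable_of_hasCompactSupport
        hasCompactSupport_radialWeight).mul_const _) (ae_of_all _ fun x => ?_)
    rw [← smul_sub, norm_smul, Real.norm_of_nonneg (radialWeight_nonneg x)]
    by_cases hx : x ∈ Metric.closedBall (0 : E) 1
    · refine mul_le_mul_of_nonneg_left ?_ (radialWeight_nonneg x)
      rw [← dist_eq_norm, dist_comm]
      refine (hg _ ?_).le
      rw [mem_closedBall_zero_iff] at hx
      simpa [norm_smul] using mul_le_of_le_one_right (abs_nonneg s) hx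
    · rw [Function.notMem_support.1 fun h => hx (support_radialWeight_subset h)]
      simp
  rw [integral_mul_const, ← hc] at h2
  refine h2.trans_lt ?_
  rw [← mul_div_assoc, div_lt_iff₀ (by positivity)]
  nlinarith

/-- Harmonicity is a closed condition in the compact-open topology, as it amounts to the mean value
property. -/
theorem isClosed_harmonic [CompleteSpace F] [Nontrivial E] :
    IsClosed {f : C(E, F) | ∃ h : ContDiff ℝ ∞ f, smoothLaplacian (⟨f, h⟩ : SmoothMaps E F) = 0} := by
  borelize E
  have h : {f : C(E, F) | ∃ h : ContDiff ℝ ∞ f, smoothLaplacian (⟨f, h⟩ : SmoothMaps E F) = 0} =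
      ⋂ (y : E) (s : ℝ), {f : C(E, F) | ∫ x, radialWeight x • f (y + s • x) =
        (∫ x : E, radialWeight x) • f y} := by
    ext f
    simp only [Set.mem_iInter, Set.mem_ofPred_eq]
    constructor
    · rintro ⟨h, hf⟩ y s
      exact radialMean_eq hf y s
    · intro hf
      have hs : ContDiff ℝ ∞ f := contDiff_of_radialMean f.continuous fun y => by
        simpa using hf y 1
      exact ⟨hs, smoothLaplacian_eq_zero_of_radialMean hf⟩
  rw [h]
  exact isClosed_iInter fun y => isClosed_iInter fun s =>
    isClosed_eq (continuous_radialMean y s) ((continuous_eval_const y).const_smul _)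

end Closed

section HarmonicMaps

variable {n m : ℕ}

theorem mem_harmonicMaps_iff {f : C(EuclideanSpace ℝ (Fin n), EuclideanSpace ℝ (Fin m))} :
    f ∈ HarmonicMaps n m ↔ ∃ h : ContDiff ℝ ∞ f, smoothLaplacian
      (⟨f, h⟩ : SmoothMaps (EuclideanSpace ℝ (Fin n)) (EuclideanSpace ℝ (Fin m))) = 0 := by
  have hlap (h : ContDiff ℝ ∞ f) (i : Fin m) (x : EuclideanSpace ℝ (Fin n)) :
      Laplacian.laplacian (fun y => f y i) x = (Laplacian.laplacian (f : EuclideanSpace ℝ (Fin n) → EuclideanSpace ℝ (Fin m)) x) i :=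
    ((h.of_le two_le_infty).contDiffAt).laplacian_CLM_comp_left
      (l := EuclideanSpace.proj (𝕜 := ℝ) i)
  constructor
  · intro hf
    have h : ContDiff ℝ ∞ f := contDiff_euclidean.2 fun i => (hf i).1
    refine ⟨h, ?_⟩
    ext x i
    rw [smoothLaplacian_apply]
    exact (hlap h i x).symm.trans ((hf i).2 x)
  · rintro ⟨h, hf⟩ i
    refine ⟨contDiff_euclidean.1 h i, fun x => ?_⟩
    rw [hlap h i x, ← smoothLaplacian_apply ⟨f, h⟩, hf]
    rfl

theorem isClosed_harmonicMaps (hn : n ≠ 0) :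
    IsClosed (HarmonicMaps n m :
      Set C(EuclideanSpace ℝ (Fin n), EuclideanSpace ℝ (Fin m))) := by
  have : NeZero n := ⟨hn⟩
  convert isClosed_harmonic (E := EuclideanSpace ℝ (Fin n)) (F := EuclideanSpace ℝ (Fin m)) using 1
  ext f
  exact mem_harmonicMaps_iff

/-- The inclusion of the harmonic polynomials in the space of harmonic maps. -/
noncomputable def harmonicPolynomialToMap :
    harmonicPolynomials (EuclideanSpace ℝ (Fin n)) (EuclideanSpace ℝ (Fin m)) →ₗ[ℝ]
      HarmonicMaps n m where
  toFun p := ⟨⟨p.1.1, SmoothMaps.continuous p.1⟩, mem_harmonicMaps_iff.2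
    ⟨SmoothMaps.contDiff p.1, (mem_harmonicPolynomials.1 p.2).1⟩⟩
  map_add' _ _ := rfl
  map_smul' _ _ := rfl

theorem denseRange_harmonicPolynomialToMap (hn : n ≠ 0) :
    DenseRange (harmonicPolynomialToMap (n := n) (m := m)) := by
  have : NeZero n := ⟨hn⟩
  intro f
  obtain ⟨hs, hf⟩ := mem_harmonicMaps_iff.1 f.2
  choose p hp hpf using fun k : ℕ => exists_harmonicPolynomial_norm_sub_le hf
    (Nat.cast_add_one_pos (α := ℝ) k) (Nat.one_div_pos_of_nat (α := ℝ) (n := k))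
  refine mem_closure_of_tendsto (b := Filter.atTop)
    (f := fun k => harmonicPolynomialToMap ⟨p k, hp k⟩) ?_
    (Filter.Eventually.of_forall fun k => Set.mem_range_self _)
  rw [tendsto_subtype_rng, ContinuousMap.tendsto_iff_forall_isCompact_tendstoUniformlyOn]
  intro K hK
  rw [Metric.tendstoUniformlyOn_iff]
  intro ε hε
  obtain ⟨R, hR⟩ := hK.isBounded.subset_closedBall 0
  obtain ⟨k₀, hk₀⟩ := exists_nat_ge R
  obtain ⟨k₁, hk₁⟩ := exists_nat_one_div_lt hε
  filter_upwards [Filter.eventually_ge_atTop k₀, Filter.eventually_ge_atTop k₁] with k h0 h1 x hx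
  rw [dist_eq_norm]
  refine (hpf k x ?_).trans_lt ((Nat.one_div_le_one_div h1).trans_lt hk₁)
  refine Metric.closedBall_subset_closedBall ?_ (hR hx)
  have : (k₀ : ℝ) ≤ k := by exact_mod_cast h0
  linarith

end HarmonicMaps

/-! ### Translates of decaying harmonic polynomials -/

section Decay

open Filter Topology

/-- The curves `ℝ → V` which are finite sums of terms `c(t) • p` with `c(t) → 0` as `t → ∞`. -/
def decayingCurves (V : Type*) [AddCommGroup V] [Module ℝ V] : Submodule ℝ (ℝ → V) :=
  Submodule.span ℝ {u | ∃ (c : ℝ → ℝ) (p : V), Tendsto c atTop (𝓝 0) ∧ u = fun t => c t • p}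

variable {V Y : Type*} [AddCommGroup V] [Module ℝ V]

theorem smul_mem_decayingCurves {c : ℝ → ℝ} (hc : Tendsto c atTop (𝓝 0)) (p : V) :
    (fun t => c t • p) ∈ decayingCurves V :=
  Submodule.subset_span ⟨c, p, hc, rfl⟩

/-- Decaying curves tend to zero in any vector space topology, as they live in a finite-dimensional
subspace. -/
theorem tendsto_of_mem_decayingCurves [AddCommGroup Y] [Module ℝ Y] [TopologicalSpace Y]
    [ContinuousAdd Y] [ContinuousSMul ℝ Y] (L : V →ₗ[ℝ] Y) {u : ℝ → V} (hu : u ∈ decayingCurves V) :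
    Tendsto (fun t => L (u t)) atTop (𝓝 0) := by
  induction hu using Submodule.span_induction with
  | mem u hu =>
    obtain ⟨c, p, hc, rfl⟩ := hu
    simpa using hc.smul_const (L p)
  | zero => simpa using tendsto_const_nhds
  | add u v _ _ hu hv => simpa using hu.add hv
  | smul a u _ hu => simpa using hu.const_smul a

end Decay

section Moments

open Filter Topology

/-- The vectors `(1 / (j + 1 + s)!)_{s < K}`, `j ∈ ℕ`, span `ℝ^K`. -/
theorem exists_finsupp_sum_div_factorial (K : ℕ) (β : ℕ → ℝ) :
    ∃ c : ℕ →₀ ℝ, ∀ s < K, (c.sum fun j a => a / (j + 1 + s).factorial) = β s := by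
  set v : ℕ → Fin K → ℝ := fun j s => 1 / (j + 1 + (s : ℕ)).factorial with hv
  have htop : Submodule.span ℝ (Set.range v) = ⊤ := by
    by_contra hne
    obtain ⟨f, hf0, hf⟩ := Submodule.exists_le_ker_of_lt_top _ (lt_top_iff_ne_top.2 hne)
    set l : Fin K → ℝ := fun s => f (Pi.single s 1) with hl
    have hfl (x : Fin K → ℝ) : f x = ∑ s, x s * l s := by
      conv_lhs => rw [pi_eq_sum_univ' x]
      simp [hl, map_sum]
    have hsum (j : ℕ) : ∑ s : Fin K, 1 / ((j + 1 + (s : ℕ)).factorial : ℝ) * l s = 0 := by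
      rw [← hfl (v j)]
      exact hf (Submodule.subset_span ⟨j, rfl⟩)
    -- By strong induction, the leading term as `j → ∞` shows that every `l s` vanishes.
    have hl0 : ∀ (s : ℕ) (hs : s < K), l ⟨s, hs⟩ = 0 := by
      intro s
      induction s using Nat.strong_induction_on with
      | _ s ih =>
        intro hs
        have h1 : Tendsto (fun j : ℕ => ∑ r : Fin K,
            ((j + 1 + s).factorial : ℝ) / ((j + 1 + (r : ℕ)).factorial : ℝ) * l r) atTop
            (𝓝 (∑ r : Fin K, if r = ⟨s, hs⟩ then l r else 0)) := by
          refine tendsto_finsetSum _ fun r _ => ?_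
          rcases lt_trichotomy (r : ℕ) s with h | h | h
          · simp [ih r h r.2]
          · have hr : r = ⟨s, hs⟩ := Fin.ext h
            subst hr
            refine tendsto_const_nhds.congr fun j => ?_
            have := Nat.factorial_ne_zero (j + 1 + s)
            simp [this]
          · have hr : r ≠ ⟨s, hs⟩ := fun hr => h.ne' (congrArg Fin.val hr)
            rw [if_neg hr]
            have h2 : Tendsto (fun j : ℕ => ((j + 1 + s).factorial : ℝ) /
                ((j + 1 + (r : ℕ)).factorial : ℝ)) atTop (𝓝 0) := by
              refine squeeze_zero (fun j => by positivity) (fun j => ?_)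
                tendsto_one_div_add_atTop_nhds_zero_nat
              rw [div_le_div_iff₀ (by positivity) (by positivity), one_mul]
              have h3 : (j + 1 + s).factorial * (j + 1) ≤ (j + 1 + (r : ℕ)).factorial := by
                refine le_trans ?_ (Nat.factorial_le (show j + 1 + s + 1 ≤ j + 1 + r by omega))
                rw [Nat.factorial_succ, mul_comm]
                gcongr
                omega
              exact_mod_cast h3
            simpa using h2.mul_const (l r)
        have h2 : (fun j : ℕ => ∑ r : Fin K,
            ((j + 1 + s).factorial : ℝ) / ((j + 1 + (r : ℕ)).factorial : ℝ) * l r) = fun _ => 0 := by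
          funext j
          have h3 := congrArg (fun x => ((j + 1 + s).factorial : ℝ) * x) (hsum j)
          simp only [Finset.mul_sum, mul_zero] at h3
          rw [← h3]
          exact Finset.sum_congr rfl fun r _ => by ring
        rw [h2] at h1
        simpa using tendsto_nhds_unique h1 tendsto_const_nhds
    refine hf0 (LinearMap.ext fun x => ?_)
    rw [hfl]
    exact Finset.sum_eq_zero fun s _ => by rw [hl0 s s.2, mul_zero]
  obtain ⟨c, hc⟩ := (Finsupp.mem_span_range_iff_exists_finsupp (v := v)
    (x := fun s : Fin K => β s)).1 (by rw [htop]; trivial)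
  refine ⟨c, fun s hs => ?_⟩
  rw [← congrFun hc ⟨s, hs⟩]
  simp [Finsupp.sum, hv, div_eq_mul_inv]

end Moments

section Translation

open Filter Topology

variable {E F : Type*} [NormedAddCommGroup E] [InnerProductSpace ℝ E]
  [NormedAddCommGroup F] [NormedSpace ℝ F] [FiniteDimensional ℝ E]

/-- Every combination `∑ β_s t^s ∂_a^s f` of derivatives of a harmonic polynomial `f` is, up to a
decaying error, the translate by `t a` of a harmonic polynomial which itself decays as `t → ∞`. The
latter is a combination of the iterated primitives of `f` in the direction `a`. -/
theorem exists_decaying_translate (hdim : 2 ≤ Module.finrank ℝ E) {a : E} (ha : a ≠ 0)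
    (f : harmonicPolynomials E F) {K : ℕ} (hK : (dirDeriv a ^ K) f.1 = 0) (β : ℕ → ℝ) :
    ∃ u ∈ decayingCurves (harmonicPolynomials E F), ∃ r ∈ decayingCurves (harmonicPolynomials E F),
      ∀ (t : ℝ), 0 < t → ∀ x : E, (u t).1.1 (x + t • a) =
        ∑ s ∈ Finset.range K, (β s * t ^ s) • ((dirDeriv a ^ s) f.1).1 x + (r t).1.1 x := by
  obtain ⟨c, hc⟩ := exists_finsupp_sum_div_factorial K β
  choose I hIP hI using fun q : harmonicPolynomials E F =>
    exists_harmonicPolynomial_dirDeriv_eq hdim ha q.2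
  -- `P j` is the `j`-th iterated primitive of `f`.
  set P : ℕ → harmonicPolynomials E F := fun j => (fun q => ⟨I q, hIP q⟩)^[j] f with hP
  have hP0 : P 0 = f := rfl
  have hPs (j : ℕ) : dirDeriv a (P (j + 1)).1 = (P j).1 := by
    simp only [hP, Function.iterate_succ_apply', hI]
  have hlow (i j : ℕ) : (dirDeriv a ^ i) (P (i + j)).1 = (P j).1 := by
    induction i with
    | zero => simp
    | succ i ih =>
      rw [pow_succ, Module.End.mul_apply, show i + 1 + j = i + j + 1 by ring, hPs, ih]
  have hhigh (j s : ℕ) : (dirDeriv a ^ (j + s)) (P j).1 = (dirDeriv a ^ s) f.1 := by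
    rw [add_comm, pow_add, Module.End.mul_apply]
    congr 1
    exact hlow j 0
  have hdecay {i j : ℕ} (hij : i < j) (b : ℝ) :
      Tendsto (fun t : ℝ => b * (t ^ i / t ^ j)) atTop (𝓝 0) := by
    simpa using (tendsto_pow_div_pow_atTop_zero hij).const_mul b
  refine ⟨∑ j ∈ c.support, fun t => (c j * (t ^ 0 / t ^ (j + 1))) • P (j + 1),
    sum_mem fun j _ => smul_mem_decayingCurves (hdecay j.succ_pos _) _,
    ∑ j ∈ c.support, ∑ i ∈ Finset.range (j + 1),
      fun t => (c j / i.factorial * (t ^ i / t ^ (j + 1))) • P (j + 1 - i),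
    sum_mem fun j _ => sum_mem fun i hi =>
      smul_mem_decayingCurves (hdecay (Finset.mem_range.1 hi) _) _, fun t ht x => ?_⟩
  -- Taylor's formula: the terms with `i ≤ j` still contain a primitive and decay, the others are
  -- derivatives of `f`.
  have hterm (j : ℕ) : (P (j + 1)).1.1 (x + t • a) =
      ∑ i ∈ Finset.range (j + 1), (t ^ i / i.factorial) • (P (j + 1 - i)).1.1 x +
      ∑ s ∈ Finset.range K, (t ^ (j + 1 + s) / (j + 1 + s).factorial) •
        ((dirDeriv a ^ s) f.1).1 x := by
    rw [apply_add_smul_of_dirDeriv_pow_eq_zero (K := j + 1 + K) (by rw [hhigh, hK]),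
      Finset.sum_range_add]
    congr 1
    · refine Finset.sum_congr rfl fun i hi => ?_
      have h := hlow i (j + 1 - i)
      rw [Nat.add_sub_cancel' (Finset.mem_range.1 hi).le] at h
      rw [h]
    · exact Finset.sum_congr rfl fun s _ => by rw [hhigh]
  have h1 : ((∑ j ∈ c.support, fun t => (c j * (t ^ 0 / t ^ (j + 1))) • P (j + 1)) t).1.1
      (x + t • a) = ∑ j ∈ c.support, (c j * (t ^ 0 / t ^ (j + 1))) • (P (j + 1)).1.1 (x + t • a) := by
    simp
  have h2 : ((∑ j ∈ c.support, ∑ i ∈ Finset.range (j + 1),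
      fun t => (c j / i.factorial * (t ^ i / t ^ (j + 1))) • P (j + 1 - i)) t).1.1 x =
      ∑ j ∈ c.support, ∑ i ∈ Finset.range (j + 1),
        (c j / i.factorial * (t ^ i / t ^ (j + 1))) • (P (j + 1 - i)).1.1 x := by
    simp
  rw [h1, h2, add_comm (∑ s ∈ Finset.range K, _)]
  have h3 : ∑ s ∈ Finset.range K, (β s * t ^ s) • ((dirDeriv a ^ s) f.1).1 x =
      ∑ j ∈ c.support, ∑ s ∈ Finset.range K,
        (c j / (j + 1 + s).factorial * t ^ s) • ((dirDeriv a ^ s) f.1).1 x := by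
    rw [Finset.sum_comm]
    refine Finset.sum_congr rfl fun s hs => ?_
    rw [← Finset.sum_smul, ← Finset.sum_mul, ← hc s (Finset.mem_range.1 hs)]
    rfl
  rw [h3, ← Finset.sum_add_distrib]
  refine Finset.sum_congr rfl fun j _ => ?_
  rw [hterm, smul_add, Finset.smul_sum, Finset.smul_sum]
  congr 1
  · refine Finset.sum_congr rfl fun i _ => ?_
    rw [smul_smul]
    congr 1
    ring
  · refine Finset.sum_congr rfl fun s _ => ?_
    rw [smul_smul, pow_add t (j + 1)]
    congr 1
    field_simp

/-- Far translates of suitable small perturbations of a harmonic polynomial `f` come close to any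
given harmonic polynomial `g`. -/
theorem exists_decaying_perturbation (hdim : 2 ≤ Module.finrank ℝ E) {a : E} (ha : a ≠ 0)
    (f g : harmonicPolynomials E F) :
    ∃ u ∈ decayingCurves (harmonicPolynomials E F), ∃ r ∈ decayingCurves (harmonicPolynomials E F),
      ∀ (t : ℝ), 0 < t → ∀ x : E, (f + u t).1.1 (x + t • a) = (g + r t).1.1 x := by
  obtain ⟨K, hK⟩ := mem_polynomialMaps.1 f.2.2
  obtain ⟨L, hL⟩ := mem_polynomialMaps.1 g.2.2
  have hK := dirDeriv_pow_apply_eq_zero hK a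
  have hL := dirDeriv_pow_apply_eq_zero (polyDegreeLT_mono L.le_succ hL) a
  -- The first perturbation cancels the Taylor expansion of `f`, the second one produces `g`.
  obtain ⟨u, hu, r, hr, h⟩ := exists_decaying_translate hdim ha f hK fun s => -(1 / s.factorial)
  obtain ⟨u', hu', r', hr', h'⟩ := exists_decaying_translate hdim ha g hL
    fun s => if s = 0 then 1 else 0
  refine ⟨u + u', add_mem hu hu', r + r', add_mem hr hr', fun t ht x => ?_⟩
  have h1 : (f + (u + u') t).1.1 (x + t • a) =
      f.1.1 (x + t • a) + ((u t).1.1 (x + t • a) + (u' t).1.1 (x + t • a)) := rfl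
  have h2 : (g + (r + r') t).1.1 x = g.1.1 x + ((r t).1.1 x + (r' t).1.1 x) := rfl
  have h3 : ∑ s ∈ Finset.range (L + 1), ((if s = 0 then (1 : ℝ) else 0) * t ^ s) •
      ((dirDeriv a ^ s) g.1).1 x = g.1.1 x := by
    rw [Finset.sum_range_succ']
    simp
  have h4 : ∑ s ∈ Finset.range K, (-(1 / (s.factorial : ℝ)) * t ^ s) •
      ((dirDeriv a ^ s) f.1).1 x = -f.1.1 (x + t • a) := by
    rw [apply_add_smul_of_dirDeriv_pow_eq_zero hK, ← Finset.sum_neg_distrib]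
    refine Finset.sum_congr rfl fun s _ => ?_
    rw [← neg_smul]
    congr 1
    ring
  rw [h1, h2, h t ht x, h' t ht x, h3, h4]
  abel

end Translation

/-! ### Growth of polynomials and iterates of translations -/

section Growth

variable {E F : Type*} [NormedAddCommGroup E] [InnerProductSpace ℝ E] [FiniteDimensional ℝ E]
  [NormedAddCommGroup F] [NormedSpace ℝ F]

/-- A polynomial map of degree `< K` is bounded by a multiple of `(1 + ‖x‖) ^ K`; the exponent `K`
instead of `K - 1` keeps the induction simple. -/
theorem exists_norm_le_of_mem_polyDegreeLT {K : ℕ} {f : SmoothMaps E F} (hf : f ∈ polyDegreeLT K) :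
    ∃ C : ℝ, 0 ≤ C ∧ ∀ x, ‖f.1 x‖ ≤ C * (1 + ‖x‖) ^ K := by
  induction K generalizing f with
  | zero =>
    obtain rfl : f = 0 := hf
    exact ⟨0, le_rfl, by simp⟩
  | succ K ih =>
    set b := stdOrthonormalBasis ℝ E
    choose C hC0 hC using fun i => ih (mem_polyDegreeLT_succ.1 hf (b i))
    refine ⟨‖f.1 0‖ + ∑ i, C i, by have := Finset.sum_nonneg fun i (_ : i ∈ Finset.univ) => hC0 i
                                   positivity, fun x => ?_⟩
    have hd (z : E) (hz : z ∈ Metric.closedBall (0 : E) ‖x‖) :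
        ‖fderiv ℝ f.1 z‖ ≤ (∑ i, C i) * (1 + ‖x‖) ^ K := by
      rw [mem_closedBall_zero_iff] at hz
      refine ContinuousLinearMap.opNorm_le_bound _ (by
        have := Finset.sum_nonneg fun i (_ : i ∈ Finset.univ) => hC0 i
        positivity) fun v => ?_
      have h1 : fderiv ℝ f.1 z v = ∑ i, inner ℝ (b i) v • (dirDeriv (b i) f).1 z := by
        conv_lhs => rw [← b.sum_repr' v]
        simp [dirDeriv_apply]
      rw [h1, Finset.sum_mul, Finset.sum_mul]
      refine norm_sum_le_of_le _ fun i _ => ?_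
      rw [norm_smul, mul_comm]
      have h2 : ‖(inner ℝ (b i) v : ℝ)‖ ≤ ‖v‖ := by
        simpa using norm_inner_le_norm (𝕜 := ℝ) (b i) v
      have h3 : ‖(dirDeriv (b i) f).1 z‖ ≤ C i * (1 + ‖x‖) ^ K :=
        (hC i z).trans (by gcongr; exact hC0 i)
      exact mul_le_mul h3 h2 (norm_nonneg _) ((norm_nonneg _).trans h3)
    have h1 := (convex_closedBall (0 : E) ‖x‖).norm_image_sub_le_of_norm_fderiv_le
      (fun z _ => SmoothMaps.differentiable f z) hd (x := 0) (y := x) (by simp) (by simp)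
    rw [sub_zero] at h1
    have h2 : ‖f.1 x‖ ≤ ‖f.1 0‖ + ‖f.1 x - f.1 0‖ := norm_le_insert' _ _
    have h3 : (1 : ℝ) ≤ (1 + ‖x‖) ^ (K + 1) := one_le_pow₀ (by linarith [norm_nonneg x])
    have hS := Finset.sum_nonneg fun i (_ : i ∈ Finset.univ) => hC0 i
    calc ‖f.1 x‖ ≤ ‖f.1 0‖ * 1 + (∑ i, C i) * (1 + ‖x‖) ^ K * ‖x‖ := by linarith
      _ ≤ ‖f.1 0‖ * (1 + ‖x‖) ^ (K + 1) + (∑ i, C i) * (1 + ‖x‖) ^ K * (1 + ‖x‖) := by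
        gcongr; linarith
      _ = _ := by ring

/-- A continuous positive radial weight of faster than polynomial growth dominates every polynomial
map up to a constant. -/
theorem exists_norm_le_mul_weight {φ : ℝ≥0 → ℝ} (hφ_cont : Continuous φ) (hφ_pos : ∀ r, 0 < φ r)
    (hφ_growth : ∀ N : ℕ, 1 ≤ N →
      Filter.Tendsto (fun r : ℝ≥0 => φ r / (r : ℝ) ^ N) Filter.atTop Filter.atTop)
    {f : SmoothMaps E F} (hf : f ∈ polynomialMaps E F) :
    ∃ C : ℝ, ∀ x, ‖f.1 x‖ ≤ C * φ ‖x‖₊ := by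
  obtain ⟨K, hK⟩ := mem_polynomialMaps.1 hf
  obtain ⟨C, hC0, hC⟩ := exists_norm_le_of_mem_polyDegreeLT (polyDegreeLT_mono K.le_succ hK)
  obtain ⟨R, hR⟩ := Filter.eventually_atTop.1
    ((hφ_growth (K + 1) (by omega)).eventually_ge_atTop 1)
  have hcont : Continuous fun x : E => φ ‖x‖₊ := hφ_cont.comp continuous_nnnorm
  obtain ⟨A, hA⟩ := (isCompact_closedBall (0 : E) (max R 1 : ℝ≥0)).exists_bound_of_continuousOn
    (f := fun x => (φ ‖x‖₊)⁻¹ • f.1 x)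
    ((hcont.inv₀ fun x => (hφ_pos _).ne').smul (SmoothMaps.continuous f)).continuousOn
  refine ⟨max A (C * 2 ^ (K + 1)), fun x => ?_⟩
  have hφx := hφ_pos ‖x‖₊
  by_cases hx : x ∈ Metric.closedBall (0 : E) (max R 1 : ℝ≥0)
  · have h1 := hA x hx
    rw [norm_smul, norm_inv, Real.norm_of_nonneg hφx.le, inv_mul_le_iff₀ hφx, mul_comm] at h1
    exact h1.trans (mul_le_mul_of_nonneg_right (le_max_left _ _) hφx.le)
  · rw [mem_closedBall_zero_iff, not_le] at hx
    have hx' : max R 1 < ‖x‖₊ := by exact_mod_cast hx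
    have hx1 : 1 ≤ ‖x‖ := by exact_mod_cast (le_max_right R 1).trans hx'.le
    have h1 := hR ‖x‖₊ ((le_max_left _ _).trans hx'.le)
    rw [coe_nnnorm, le_div_iff₀ (by positivity), one_mul] at h1
    calc ‖f.1 x‖ ≤ C * (1 + ‖x‖) ^ (K + 1) := hC x
      _ ≤ C * (2 * ‖x‖) ^ (K + 1) := by gcongr; linarith
      _ = C * 2 ^ (K + 1) * ‖x‖ ^ (K + 1) := by rw [mul_pow, mul_assoc]
      _ ≤ C * 2 ^ (K + 1) * φ ‖x‖₊ := by gcongr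
      _ ≤ _ := mul_le_mul_of_nonneg_right (le_max_right _ _) hφx.le

end Growth

section HarmonicTranslation

open Filter Topology

variable {n m : ℕ}

theorem harmonicTranslation_apply (a x : EuclideanSpace ℝ (Fin n)) (f : HarmonicMaps n m) :
    (harmonicTranslation a f).1 x = f.1 (x + a) := rfl

theorem harmonicMaps_ext {f g : HarmonicMaps n m} (h : ∀ x, f.1 x = g.1 x) : f = g :=
  Subtype.ext (ContinuousMap.ext h)

theorem harmonicTranslation_harmonicTranslation (a b : EuclideanSpace ℝ (Fin n))
    (f : HarmonicMaps n m) :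
    harmonicTranslation a (harmonicTranslation b f) = harmonicTranslation (a + b) f :=
  harmonicMaps_ext fun x => by simp [harmonicTranslation_apply, add_assoc]

theorem harmonicTranslation_zero (f : HarmonicMaps n m) : harmonicTranslation 0 f = f :=
  harmonicMaps_ext fun x => by simp [harmonicTranslation_apply]

theorem iterate_harmonicTranslation (a : EuclideanSpace ℝ (Fin n)) (N : ℕ) (f : HarmonicMaps n m) :
    (harmonicTranslation a)^[N] f = harmonicTranslation ((N : ℝ) • a) f := by
  induction N with
  | zero => simp [harmonicTranslation_zero]
  | succ N ih =>
    have h : a + (N : ℝ) • a = ((N + 1 : ℕ) : ℝ) • a := by push_cast; module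
    rw [Function.iterate_succ_apply', ih, harmonicTranslation_harmonicTranslation, h]

theorem continuous_harmonicTranslation :
    Continuous fun p : EuclideanSpace ℝ (Fin n) × HarmonicMaps n m =>
      harmonicTranslation p.1 p.2 := by
  refine Continuous.subtype_mk (ContinuousMap.continuous_of_continuous_uncurry _ ?_) _
  change Continuous fun q : (EuclideanSpace ℝ (Fin n) × HarmonicMaps n m) ×
    EuclideanSpace ℝ (Fin n) => q.1.2.1 (q.2 + q.1.1)
  exact (continuous_subtype_val.comp (continuous_snd.comp continuous_fst)).eval
    (continuous_snd.add (continuous_fst.comp continuous_fst))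

theorem mem_hypercyclicElements_iff {X : Type*} [TopologicalSpace X] {T : X → X} {x : X} :
    x ∈ HypercyclicElements T ↔ ∀ U : Set X, IsOpen U → U.Nonempty → ∃ N : ℕ, T^[N] x ∈ U := by
  change Dense _ ↔ _
  rw [dense_iff_inter_open]
  refine forall₃_congr fun U _ _ => ⟨?_, ?_⟩
  · rintro ⟨_, h, N, rfl⟩
    exact ⟨N, h⟩
  · rintro ⟨N, h⟩
    exact ⟨_, h, N, rfl⟩

/-- A hypercyclic element of `T_e` is hypercyclic for `T_{re}`, as soon as `T_{re}` has some
hypercyclic element `g`: all translates `T_{θe} g` are hypercyclic for `T_{re}`, so it suffices to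
bring `f` close to `g` by a translation and to correct the length of that translation modulo `r` by
some `θ ∈ [0, r]`. -/
theorem hypercyclicElements_smul {e : EuclideanSpace ℝ (Fin n)} {r : ℝ} (hr : 0 < r)
    {f g : HarmonicMaps n m} (hf : f ∈ HypercyclicElements (harmonicTranslation (m := m) e))
    (hg : g ∈ HypercyclicElements (harmonicTranslation (m := m) (r • e))) :
    f ∈ HypercyclicElements (harmonicTranslation (m := m) (r • e)) := by
  rw [mem_hypercyclicElements_iff] at hf hg ⊢
  intro U hU hUne
  set O : Set (ℝ × HarmonicMaps n m) :=
    ⋃ N : ℕ, {p | harmonicTranslation ((N * r + p.1) • e) p.2 ∈ U} with hO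
  have hOo : IsOpen O := isOpen_iUnion fun N => hU.preimage
    (continuous_harmonicTranslation.comp (by fun_prop :
      Continuous fun p : ℝ × HarmonicMaps n m => ((N * r + p.1) • e, p.2)))
  -- `g` is hypercyclic for `T_{re}`, so it visits the preimage of `U` under each `T_{θe}`.
  have hsub : Set.Icc 0 r ×ˢ {g} ⊆ O := by
    rintro ⟨θ, g'⟩ ⟨-, rfl⟩
    obtain ⟨h, hh⟩ := hUne
    obtain ⟨N, hN⟩ := hg _ (hU.preimage (harmonicTranslation (m := m) (θ • e)).continuous)
      ⟨harmonicTranslation (-(θ • e)) h, by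
        rw [Set.mem_preimage, harmonicTranslation_harmonicTranslation, add_neg_cancel,
          harmonicTranslation_zero]
        exact hh⟩
    rw [Set.mem_preimage, iterate_harmonicTranslation, harmonicTranslation_harmonicTranslation] at hN
    refine Set.mem_iUnion.2 ⟨N, ?_⟩
    rw [Set.mem_ofPred_eq]
    convert hN using 3
    module
  obtain ⟨I, V, -, hV, hI, hgV, hIV⟩ := generalized_tube_lemma isCompact_Icc
    (isCompact_singleton (x := g)) hOo hsub
  obtain ⟨k, hk⟩ := hf V hV ⟨g, hgV rfl⟩
  rw [iterate_harmonicTranslation] at hk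
  -- `M r` is the least multiple of `r` that is at least `k`, so `θ = M r - k` lies in `[0, r]`.
  set M : ℕ := ⌈(k : ℝ) / r⌉₊ with hM
  have h1 : (k : ℝ) ≤ M * r := (div_le_iff₀ hr).1 (Nat.le_ceil _)
  have h2 : (M : ℝ) * r < k + r := by
    have := Nat.ceil_lt_add_one (a := (k : ℝ) / r) (by positivity)
    rwa [div_add_one hr.ne', lt_div_iff₀ hr] at this
  have hMI : (M : ℝ) * r - k ∈ Set.Icc 0 r := ⟨by linarith, by linarith⟩
  obtain ⟨N, hN⟩ := Set.mem_iUnion.1 (hIV (Set.mk_mem_prod (hI hMI) hk))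
  rw [Set.mem_ofPred_eq, harmonicTranslation_harmonicTranslation] at hN
  refine ⟨N + M, ?_⟩
  rw [iterate_harmonicTranslation]
  convert hN using 3
  push_cast
  module

end HarmonicTranslation

/-! ### Banach spaces of harmonic maps of slow growth -/

section WeightedSpace

open Filter Topology BoundedContinuousFunction

variable {E F : Type*} [NormedAddCommGroup E] [InnerProductSpace ℝ E]
  [NormedAddCommGroup F] [NormedSpace ℝ F]

/-- Multiplication of bounded continuous maps by a continuous weight. -/
noncomputable def mulWeight (w : C(E, ℝ)) : (E →ᵇ F) →L[ℝ] C(E, F) where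
  toFun b := ⟨fun x => w x • b x, by fun_prop⟩
  map_add' b c := by ext x; simp
  map_smul' a b := by ext x; simp [smul_comm a]
  cont := ContinuousMap.continuous_of_continuous_uncurry _
    ((w.continuous.comp continuous_snd).smul (continuous_fst.eval continuous_snd))

variable [FiniteDimensional ℝ E]

/-- The harmonic polynomials divided by a weight which dominates them, as bounded continuous maps. -/
noncomputable def divWeight (w : C(E, ℝ)) (hw : ∀ x, 0 < w x)
    (h : ∀ p ∈ harmonicPolynomials E F, ∃ C : ℝ, ∀ x, ‖p.1 x‖ ≤ C * w x) :
    harmonicPolynomials E F →ₗ[ℝ] (E →ᵇ F) where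
  toFun p := BoundedContinuousFunction.ofNormedAddCommGroup (fun x => (w x)⁻¹ • p.1.1 x)
    ((w.continuous.inv₀ fun x => (hw x).ne').smul (SmoothMaps.continuous p.1))
    (h p.1 p.2).choose fun x => by
      rw [norm_smul, norm_inv, Real.norm_of_nonneg (hw x).le, inv_mul_le_iff₀ (hw x), mul_comm]
      exact (h p.1 p.2).choose_spec x
  map_add' p q := by ext x; simp
  map_smul' a p := by ext x; simp [smul_comm a]

end WeightedSpace

section Main

open Filter Topology BoundedContinuousFunction

variable {n m : ℕ}

instance : ContinuousAdd (HarmonicMaps n m) :=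
  (HarmonicMaps n m).toAddSubmonoid.continuousAdd

instance : SecondCountableTopology (HarmonicMaps n m) :=
  TopologicalSpace.Subtype.secondCountableTopology _

/-- Topological transitivity: if the harmonic polynomials are dense in `S`, some elements of every
nonempty open subset of `S` are moved into a given nonempty open set of harmonic maps by the iterates
of `T_a`. -/
theorem dense_iUnion_iterate_harmonicTranslation_mem {S : Type*} [AddCommGroup S] [Module ℝ S]
    [TopologicalSpace S] [ContinuousAdd S] [ContinuousSMul ℝ S] (hn : 2 ≤ n)
    (Q : harmonicPolynomials (EuclideanSpace ℝ (Fin n)) (EuclideanSpace ℝ (Fin m)) →ₗ[ℝ] S)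
    (hQ : DenseRange Q) (ι : S → HarmonicMaps n m) (hι : ∀ p, ι (Q p) = harmonicPolynomialToMap p)
    {a : EuclideanSpace ℝ (Fin n)} (ha : a ≠ 0) {U : Set (HarmonicMaps n m)} (hU : IsOpen U)
    (hUne : U.Nonempty) :
    Dense (⋃ N : ℕ, {b : S | (harmonicTranslation (m := m) a)^[N] (ι b) ∈ U}) := by
  rw [dense_iff_inter_open]
  intro W hW hWne
  obtain ⟨f, hf⟩ := hQ.exists_mem_open hW hWne
  obtain ⟨g, hg⟩ := (denseRange_harmonicPolynomialToMap (by omega)).exists_mem_open hU hUne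
  obtain ⟨u, hu, r, hr, h⟩ := exists_decaying_perturbation (by simpa using hn) ha f g
  have hu' := ((tendsto_of_mem_decayingCurves Q hu).const_add (Q f)).comp
    tendsto_natCast_atTop_atTop
  have hr' := ((tendsto_of_mem_decayingCurves (harmonicPolynomialToMap (n := n) (m := m))
    hr).const_add (harmonicPolynomialToMap g)).comp tendsto_natCast_atTop_atTop
  rw [add_zero] at hu' hr'
  obtain ⟨N, ⟨hN1, hN2⟩, hN⟩ := (((hu'.eventually_mem (hW.mem_nhds hf)).and
    (hr'.eventually_mem (hU.mem_nhds hg))).and (eventually_gt_atTop 0)).exists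
  refine ⟨Q (f + u N), by simpa using hN1, Set.mem_iUnion.2 ⟨N, ?_⟩⟩
  have h1 : (harmonicTranslation (m := m) a)^[N] (ι (Q (f + u N))) =
      harmonicPolynomialToMap g + harmonicPolynomialToMap (r N) := by
    rw [iterate_harmonicTranslation, hι, ← map_add]
    exact harmonicMaps_ext fun x => h N (by exact_mod_cast hN) x
  rw [Set.mem_ofPred_eq, h1]
  exact hN2

/-- The harmonic maps which are uniform limits of harmonic polynomials relative to a weight `w`
form a Banach space: the closure of the harmonic polynomials divided by `w` in the bounded continuous
maps. -/
theorem exists_banach_denseRange (hn : n ≠ 0) (w : C(EuclideanSpace ℝ (Fin n), ℝ))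
    (hw : ∀ x, 0 < w x)
    (h : ∀ p ∈ harmonicPolynomials (EuclideanSpace ℝ (Fin n)) (EuclideanSpace ℝ (Fin m)),
      ∃ C : ℝ, ∀ x, ‖p.1 x‖ ≤ C * w x) :
    ∃ (B : Type) (_ : NormedAddCommGroup B) (_ : NormedSpace ℝ B) (_ : CompleteSpace B)
      (ι : B →L[ℝ] HarmonicMaps n m)
      (Q : harmonicPolynomials (EuclideanSpace ℝ (Fin n)) (EuclideanSpace ℝ (Fin m)) →ₗ[ℝ] B),
      Function.Injective ι ∧ DenseRange Q ∧ (∀ p, ι (Q p) = harmonicPolynomialToMap p) ∧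
      ∀ b x, ‖(ι b).1 x‖ ≤ ‖b‖ * w x := by
  obtain ⟨P, hP⟩ : ∃ P, P = divWeight w hw h := ⟨_, rfl⟩
  obtain ⟨S, hS⟩ : ∃ S, S = (LinearMap.range P).topologicalClosure := ⟨_, rfl⟩
  have hSc : (S : Set (EuclideanSpace ℝ (Fin n) →ᵇ EuclideanSpace ℝ (Fin m))) =
      closure (Set.range P) := by rw [hS]; rfl
  have hPS (p) : P p ∈ S := by
    rw [← SetLike.mem_coe, hSc]
    exact subset_closure (Set.mem_range_self p)
  have hwP (p) : mulWeight w (P p) = (harmonicPolynomialToMap p).1 := by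
    ext1 x
    rw [hP]
    exact smul_inv_smul₀ (hw x).ne' _
  have hSH (b) (hb : b ∈ S) : mulWeight w b ∈ HarmonicMaps n m := by
    rw [← SetLike.mem_coe, hSc] at hb
    refine closure_minimal ?_
      ((isClosed_harmonicMaps (m := m) hn).preimage (mulWeight w).continuous) hb
    rintro _ ⟨p, rfl⟩
    rw [Set.mem_preimage, hwP]
    exact (harmonicPolynomialToMap p).2
  have hcomplete : CompleteSpace S := by
    refine IsClosed.completeSpace_coe (hs := ?_)
    rw [hSc]
    exact isClosed_closure
  let ι : S →L[ℝ] HarmonicMaps n m :=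
    ((mulWeight w).comp S.subtypeL).codRestrict (HarmonicMaps n m) fun b => hSH b b.2
  have hιapp (b : S) (x) : (ι b).1 x = w x • b.1 x := rfl
  refine ⟨S, inferInstance, inferInstance, hcomplete, ι, P.codRestrict S hPS, ?_, ?_,
    fun p => Subtype.ext (hwP p), ?_⟩
  · intro b c hbc
    ext1
    ext1 x
    have h1 : (ι b).1 x = (ι c).1 x := by rw [hbc]
    rw [hιapp, hιapp] at h1
    exact smul_right_injective _ (hw x).ne' h1
  · intro b
    rw [closure_subtype, ← Set.range_comp]
    exact hSc ▸ b.2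
  · intro b x
    rw [hιapp, norm_smul, Real.norm_of_nonneg (hw x).le, mul_comm]
    exact mul_le_mul_of_nonneg_right (b.1.norm_coe_le_norm x) (hw x).le

/-- The Baire category argument: in a Banach space of harmonic maps containing the harmonic
polynomials densely, the generic element is hypercyclic for countably many given translations. -/
theorem exists_isGδ_dense_hypercyclic (hn : 2 ≤ n) (a : ℕ → EuclideanSpace ℝ (Fin n))
    (ha : ∀ k, a k ≠ 0) {B : Type*} [NormedAddCommGroup B] [NormedSpace ℝ B] [CompleteSpace B]
    (ι : B →L[ℝ] HarmonicMaps n m)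
    (Q : harmonicPolynomials (EuclideanSpace ℝ (Fin n)) (EuclideanSpace ℝ (Fin m)) →ₗ[ℝ] B)
    (hQ : DenseRange Q) (hι : ∀ p, ι (Q p) = harmonicPolynomialToMap p) :
    ∃ G : Set B, IsGδ G ∧ Dense G ∧
      ∀ b ∈ G, ∀ k, ι b ∈ HypercyclicElements (harmonicTranslation (n := n) (m := m) (a k)) := by
  have hopen (k : ℕ) (U : Set (HarmonicMaps n m)) (hU : IsOpen U) :
      IsOpen (⋃ N : ℕ, {b : B | (harmonicTranslation (m := m) (a k))^[N] (ι b) ∈ U}) :=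
    isOpen_iUnion fun N => hU.preimage
      (((harmonicTranslation (m := m) (a k)).continuous.iterate N).comp ι.continuous)
  set 𝒰 : Set (Set (HarmonicMaps n m)) := TopologicalSpace.countableBasis (HarmonicMaps n m)
  have h𝒰c : Countable 𝒰 :=
    (TopologicalSpace.countable_countableBasis (HarmonicMaps n m)).to_subtype
  have h𝒰o (U : 𝒰) : IsOpen U.1 := TopologicalSpace.isOpen_of_mem_countableBasis U.2
  have h𝒰n (U : 𝒰) : U.1.Nonempty := TopologicalSpace.nonempty_of_mem_countableBasis U.2
  refine ⟨⋂ p : ℕ × 𝒰,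
    ⋃ N : ℕ, {b : B | (harmonicTranslation (m := m) (a p.1))^[N] (ι b) ∈ p.2.1},
    .iInter fun p => (hopen p.1 p.2 (h𝒰o p.2)).isGδ,
    dense_iInter_of_isOpen (fun p => hopen p.1 p.2 (h𝒰o p.2)) fun p =>
      dense_iUnion_iterate_harmonicTranslation_mem hn Q hQ ι hι (ha p.1) (h𝒰o p.2) (h𝒰n p.2), ?_⟩
  intro b hb k
  rw [mem_hypercyclicElements_iff]
  rintro U hU ⟨f, hf⟩
  obtain ⟨V, hV, hfV, hVU⟩ :=
    (TopologicalSpace.isBasis_countableBasis (HarmonicMaps n m)).exists_subset_of_mem_open hf hU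
  obtain ⟨N, hN⟩ := Set.mem_iUnion.1 (Set.mem_iInter.1 hb (k, ⟨V, hV⟩))
  exact ⟨N, hVU hN⟩

end Main

theorem mainTheorem5 (n m : ℕ) (hn : 2 ≤ n)
    (e : ℕ → EuclideanSpace ℝ (Fin n))
    (he : ∀ k, e k ∈ Metric.sphere (0 : EuclideanSpace ℝ (Fin n)) 1)
    (φ : ℝ≥0 → ℝ) (hφ_cont : Continuous φ) (hφ_pos : ∀ r, 0 < φ r)
    (hφ_growth : ∀ N : ℕ, 1 ≤ N →
      Filter.Tendsto (fun r : ℝ≥0 => φ r / (r : ℝ) ^ N) Filter.atTop Filter.atTop) :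
    ∃ (B : Type) (_ : NormedAddCommGroup B) (_ : NormedSpace ℝ B) (_ : CompleteSpace B)
      (ι : B →L[ℝ] HarmonicMaps n m) (G : Set B),
      Function.Injective ι ∧ IsGδ G ∧ Dense G ∧
      ι '' (G ∩ Metric.closedBall 0 1) ⊆
        (⋂ (k : ℕ) (r : ℝ) (_ : 0 < r),
          HypercyclicElements (harmonicTranslation (n := n) (m := m) (r • e k))) ∩
        SlowGrowthHarmonic n m φ := by
  have he0 (k : ℕ) : e k ≠ 0 := ne_zero_of_mem_unit_sphere ⟨e k, he k⟩
  obtain ⟨B, _, _, _, ι, Q, hι, hQ, hιQ, hbound⟩ := exists_banach_denseRange (n := n) (m := m)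
    (by omega) ⟨fun x => φ ‖x‖₊, hφ_cont.comp continuous_nnnorm⟩ (fun x => hφ_pos _)
    fun p hp => exists_norm_le_mul_weight hφ_cont hφ_pos hφ_growth hp.2
  obtain ⟨G, hGδ, hGd, hG⟩ := exists_isGδ_dense_hypercyclic hn e he0 ι Q hQ hιQ
  refine ⟨B, inferInstance, inferInstance, inferInstance, ι, G, hι, hGδ, hGd, ?_⟩
  rintro _ ⟨b, ⟨hbG, hb⟩, rfl⟩
  refine ⟨?_, fun x => ?_⟩
  · simp only [Set.mem_iInter]
    intro k r hr
    -- An auxiliary hypercyclic element of `T_{r e_k}` itself, which may depend on `r`.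
    obtain ⟨G', -, hGd', hG'⟩ := exists_isGδ_dense_hypercyclic hn (fun _ => r • e k)
      (fun _ => smul_ne_zero hr.ne' (he0 k)) ι Q hQ hιQ
    obtain ⟨b', hb'⟩ := hGd'.nonempty
    exact hypercyclicElements_smul hr (hG b hbG k) (hG' b' hb' 0)
  · rw [mem_closedBall_zero_iff] at hb
    exact (hbound b x).trans (mul_le_of_le_one_left (hφ_pos _).le hb)
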